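/- Let $\mathbb{S}^1=\mathbb{R}/\mathbb{Z}$ and $I=[0,1]$, and for $M\in\{\mathbb{S}^1,I\}$ let $\mathrm{Diff}_+^1(M)$ be the group of orientation-preserving $C^1$ diffeomorphisms of $M$ (with one-sided derivatives at the endpoints if $M=I$), with the uniform $C^1$ topology. A *maximal pseudometric* on a topological group $G$ is a continuous right-invariant pseudometric $d$ such that for every continuous right-invariant pseudometric $\rho$ on $G$ there are constants $K,C$ with $\rho\le K\cdot d+C$. An element $f\in G$ is *undistorted in $G$* if the inclusion $\langle f\rangle\hookrightarrow G$ is a quasi-isometric embedding, with respect to the right-invariant Cayley metrics of finite generating sets of $\langle f\rangle$ and the maximal pseudometrics on $G$; otherwise it is *distorted in $G$*. An element of $\mathrm{Diff}_+^1(M)$ is *$C^1$-distorted* if it is distorted in $\mathrm{Diff}_+^1(M)$ or has finite order, and *$C^1$-undistorted* otherwise. **Theorem 1.** (a) The pseudometric $d(f,g)=\sup_{x\in\mathbb{S}^1}|\log f'(x)-\log g'(x)|$ on $\mathrm{Diff}_+^1(\mathbb{S}^1)$ is maximal, and an element $f\in\mathrm{Diff}_+^1(\mathbb{S}^1)$ is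 $C^1$-undistorted if and only if it has a hyperbolic periodic point, that is, a point $x\in\mathbb{S}^1$ with $f^q(x)=x$ and $(f^q)'(x)\ne 1$ for some integer $q\ge 1$. (b) The pseudometric $d(f,g)=\sup_{x\in I}|(\log f'(x)-\log f'(0))-(\log g'(x)-\log g'(0))|$ on $\mathrm{Diff}_+^1(I)$ is maximal, and an element $f\in\mathrm{Diff}_+^1(I)$ is $C^1$-undistorted if and only if it has a hyperbolic periodic point, that is, a point $x\in I$ with $f^q(x)=x$ and $(f^q)'(x)\ne 1$ for some integer $q\ge 1$. -/

import Mathlib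

open Set

noncomputable section

/-! ### Large-scale geometry of groups and distortion -/

section Coarse

variable {G : Type*} [Group G]

/-- `d` is a right-invariant pseudometric on the group `G` which is continuous as a function on
`G × G` (non-negativity follows from the other axioms). -/
structure IsContRightInvPseudometric [TopologicalSpace G] (d : G → G → ℝ) : Prop where
  self_eq_zero : ∀ x, d x x = 0
  symm : ∀ x y, d x y = d y x
  triangle : ∀ x y z, d x z ≤ d x y + d y z
  right_inv : ∀ x y g, d (x * g) (y * g) = d x y
  cont : Continuous fun p : G × G => d p.1 p.2

/-- A maximal pseudometric: a continuous right-invariant pseudometric which dominates every other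
one up to multiplicative and additive constants. -/
structure IsMaximalPseudometric [TopologicalSpace G] (d : G → G → ℝ) : Prop
    extends IsContRightInvPseudometric d where
  maximal : ∀ ρ : G → G → ℝ, IsContRightInvPseudometric ρ →
    ∃ K C : ℝ, ∀ x y, ρ x y ≤ K * d x y + C

/-- The word length of `g` with respect to `S`: the least length of a word in the letters
`S ∪ S⁻¹` which represents `g`. (Only used when `S` generates `G`.) -/
def wordLength (S : Set G) (g : G) : ℕ :=
  sInf {n : ℕ | ∃ l : List G, l.length = n ∧ (∀ s ∈ l, s ∈ S ∨ s⁻¹ ∈ S) ∧ l.prod = g}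

/-- The right-invariant Cayley metric on `G` with respect to the generating set `S`. -/
def cayleyDist (S : Set G) (x y : G) : ℝ := (wordLength S (x * y⁻¹) : ℝ)

/-- `i` is a quasi-isometric embedding of `(X, dX)` into `(Y, dY)`. -/
def IsQuasiIsometricEmbedding {X Y : Type*} (dX : X → X → ℝ) (dY : Y → Y → ℝ) (i : X → Y) :
    Prop :=
  ∃ K C : ℝ, 1 ≤ K ∧ 0 ≤ C ∧ ∀ x y,
    K⁻¹ * dX x y - C ≤ dY (i x) (i y) ∧ dY (i x) (i y) ≤ K * dX x y + C

/-- `f` is undistorted in the topological group `G`: the inclusion of the cyclic group `⟨f⟩` in `G`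
is a quasi-isometric embedding, with respect to the right-invariant Cayley metrics of finite
generating sets of `⟨f⟩` and the maximal pseudometrics on `G`. -/
def IsUndistortedIn [TopologicalSpace G] (f : G) : Prop :=
  ∀ d : G → G → ℝ, IsMaximalPseudometric d →
    ∀ S : Set (Subgroup.zpowers f), S.Finite → Subgroup.closure S = ⊤ →
      IsQuasiIsometricEmbedding (cayleyDist S) d (fun x => (x : G))

/-- The convention for diffeomorphisms: torsion elements are counted as distorted. -/
def IsDistortedOrTorsion [TopologicalSpace G] (f : G) : Prop :=
  ¬ IsUndistortedIn f ∨ IsOfFinOrder f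

end Coarse

/-! ### The group of orientation-preserving `C¹` diffeomorphisms of the circle `ℝ / ℤ` -/

/-- `F` is a `C¹` lift to `ℝ`, monotone and of degree one, of the self-map `f` of the circle. -/
def IsC1Lift (F : CircleDeg1Lift) (f : UnitAddCircle → UnitAddCircle) : Prop :=
  ContDiff ℝ 1 F ∧ ∀ t : ℝ, ((F t : ℝ) : UnitAddCircle) = f (t : UnitAddCircle)

theorem IsC1Lift.one : IsC1Lift 1 id :=
  ⟨contDiff_id, fun _ => rfl⟩

theorem IsC1Lift.mul {F G : CircleDeg1Lift} {f g : UnitAddCircle → UnitAddCircle}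
    (hF : IsC1Lift F f) (hG : IsC1Lift G g) : IsC1Lift (F * G) (f ∘ g) :=
  ⟨hF.1.comp hG.1, fun t => by
    rw [CircleDeg1Lift.mul_apply, hF.2, hG.2]; rfl⟩

theorem IsC1Lift.periodic {F : CircleDeg1Lift} : Function.Periodic (deriv F) (1 : ℝ) := fun t => by
  rw [← deriv_comp_add_const]
  simp [deriv_add_const]

/-- The orientation-preserving `C¹` diffeomorphisms of the circle `ℝ / ℤ`: bijections `f` such that
`f` and `f⁻¹` are `C¹` and orientation-preserving. -/
def circleDiffSubgroup : Subgroup (Equiv.Perm UnitAddCircle) where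
  carrier := {f | (∃ F, IsC1Lift F f) ∧ ∃ F, IsC1Lift F f.symm}
  mul_mem' := by
    rintro f g ⟨⟨F, hF⟩, F', hF'⟩ ⟨⟨G, hG⟩, G', hG'⟩
    exact ⟨⟨F * G, hF.mul hG⟩, G' * F', hG'.mul hF'⟩
  one_mem' := ⟨⟨1, IsC1Lift.one⟩, 1, IsC1Lift.one⟩
  inv_mem' := fun ⟨h, h'⟩ => ⟨h', h⟩

/-- The group `Diff₊¹(𝕊¹)`, with `𝕊¹ = ℝ / ℤ`. -/
def CircleDiff : Type := circleDiffSubgroup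

namespace CircleDiff

instance : Group CircleDiff := inferInstanceAs (Group circleDiffSubgroup)

instance : CoeFun CircleDiff fun _ => UnitAddCircle → UnitAddCircle := ⟨fun f => ⇑f.1⟩

/-- The derivative `f' : 𝕊¹ → ℝ`, computed from a lift of `f`. -/
def deriv (f : CircleDiff) : UnitAddCircle → ℝ :=
  (IsC1Lift.periodic (F := f.2.1.choose)).lift

/-- The derivative does not depend on the lift. -/
theorem deriv_coe (f : CircleDiff) {F : CircleDeg1Lift} (hF : IsC1Lift F f) (t : ℝ) :
    f.deriv (t : UnitAddCircle) = _root_.deriv F t := by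
  set G := f.2.1.choose with hGdef
  have hG : IsC1Lift G f := f.2.1.choose_spec
  have key : ∀ s, ∃ n : ℤ, F s - G s = n := fun s => by
    have h : ((F s - G s : ℝ) : UnitAddCircle) = 0 := by
      rw [AddCircle.coe_sub, hF.2, hG.2, sub_self]
    obtain ⟨n, hn⟩ := (AddCircle.coe_eq_zero_iff (1 : ℝ)).1 h
    exact ⟨n, by simpa using hn.symm⟩
  choose n hn using key
  have hc : Continuous n := by
    rw [Int.isClosedEmbedding_coe_real.isEmbedding.continuous_iff]
    exact (hF.1.continuous.sub hG.1.continuous).congr hn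
  have hF' : ∀ s, F s = G s + n 0 := fun s => by
    have : n s = n 0 := PreconnectedSpace.constant inferInstance hc
    rw [← this, ← hn]; ring
  have : (F : ℝ → ℝ) = fun s => G s + n 0 := funext hF'
  rw [this, deriv_add_const]
  exact Function.Periodic.lift_coe _ _

/-- The uniform `C¹` topology: uniform convergence of `f` together with `f'`. -/
instance : TopologicalSpace CircleDiff :=
  TopologicalSpace.induced
    (fun f => (UniformFun.ofFun (f : UnitAddCircle → UnitAddCircle), UniformFun.ofFun f.deriv))
    inferInstance

/-- The pseudometric `sup |log f' - log g'|`. -/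
def logDist (f g : CircleDiff) : ℝ :=
  ⨆ x : UnitAddCircle, |Real.log (f.deriv x) - Real.log (g.deriv x)|

/-- `f` has a hyperbolic periodic point. -/
def HasHyperbolicPeriodicPoint (f : CircleDiff) : Prop :=
  ∃ x : UnitAddCircle, ∃ q : ℕ, 0 < q ∧ (f ^ q) x = x ∧ (f ^ q).deriv x ≠ 1

end CircleDiff

/-! ### The group of orientation-preserving `C¹` diffeomorphisms of the interval `[0, 1]` -/

/-- A self-map of `[0, 1]` as a real function, extended to `ℝ` by constants. -/
def intervalExtend (f : unitInterval → unitInterval) : ℝ → ℝ :=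
  IccExtend (zero_le_one : (0 : ℝ) ≤ 1) fun x => (f x : ℝ)

theorem intervalExtend_coe (f : unitInterval → unitInterval) (x : unitInterval) :
    intervalExtend f x = f x :=
  IccExtend_val _ _ x

/-- The orientation-preserving `C¹` diffeomorphisms of `[0, 1]`: increasing bijections `f` such that
`f` and `f⁻¹` are `C¹` on `[0, 1]`, with one-sided derivatives at the endpoints. -/
def intervalDiffSubgroup : Subgroup (Equiv.Perm unitInterval) where
  carrier := {f | StrictMono f ∧ ContDiffOn ℝ 1 (intervalExtend f) (Icc 0 1) ∧
    ContDiffOn ℝ 1 (intervalExtend f.symm) (Icc 0 1)}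
  mul_mem' := by
    have aux : ∀ f g : unitInterval → unitInterval,
        ContDiffOn ℝ 1 (intervalExtend f) (Icc 0 1) →
        ContDiffOn ℝ 1 (intervalExtend g) (Icc 0 1) →
        ContDiffOn ℝ 1 (intervalExtend (f ∘ g)) (Icc 0 1) := by
      intro f g hf hg
      refine (hf.comp hg fun x hx => ?_).congr fun x hx => ?_
      · rw [intervalExtend_coe g ⟨x, hx⟩]; exact (g ⟨x, hx⟩).2
      · rw [Function.comp_apply, intervalExtend_coe g ⟨x, hx⟩, intervalExtend_coe,
          intervalExtend_coe (f ∘ g) ⟨x, hx⟩, Function.comp_apply]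
    rintro f g ⟨h1, h2, h3⟩ ⟨k1, k2, k3⟩
    exact ⟨h1.comp k1, aux f g h2 k2, aux g.symm f.symm k3 h3⟩
  one_mem' := by
    have h : ContDiffOn ℝ 1 (intervalExtend id) (Icc 0 1) :=
      contDiffOn_id.congr fun x hx => intervalExtend_coe id ⟨x, hx⟩
    exact ⟨strictMono_id, h, h⟩
  inv_mem' := fun {f} ⟨h1, h2, h3⟩ => ⟨fun a b hab => by
    apply h1.lt_iff_lt.1
    simpa using hab, h3, h2⟩

/-- The group `Diff₊¹(I)`, with `I = [0, 1]`. -/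
def IntervalDiff : Type := intervalDiffSubgroup

namespace IntervalDiff

instance : Group IntervalDiff := inferInstanceAs (Group intervalDiffSubgroup)

instance : CoeFun IntervalDiff fun _ => unitInterval → unitInterval := ⟨fun f => ⇑f.1⟩

/-- The derivative `f' : I → ℝ`, one-sided at the endpoints. -/
def deriv (f : IntervalDiff) (x : unitInterval) : ℝ :=
  derivWithin (intervalExtend f) (Icc 0 1) x

/-- The uniform `C¹` topology: uniform convergence of `f` together with `f'`. -/
instance : TopologicalSpace IntervalDiff :=
  TopologicalSpace.induced
    (fun f => (UniformFun.ofFun (f : unitInterval → unitInterval), UniformFun.ofFun f.deriv))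
    inferInstance

/-- The pseudometric `sup |(log f' - log f'(0)) - (log g' - log g'(0))|`. -/
def logDist (f g : IntervalDiff) : ℝ :=
  ⨆ x : unitInterval, |(Real.log (f.deriv x) - Real.log (f.deriv 0)) -
    (Real.log (g.deriv x) - Real.log (g.deriv 0))|

/-- `f` has a hyperbolic periodic point. -/
def HasHyperbolicPeriodicPoint (f : IntervalDiff) : Prop :=
  ∃ x : unitInterval, ∃ q : ℕ, 0 < q ∧ (f ^ q) x = x ∧ (f ^ q).deriv x ≠ 1

end IntervalDiff

end

/-! The logarithmic derivative is an additive cocycle, `log (f ∘ g)' = log f' ∘ g + log g'`. The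
sup-distance of a bounded cocycle is a right-invariant pseudometric. On the interval the cocycle is
normalized by its value at the fixed point `0`, which keeps the cocycle identity.

Maximality: integrating `exp (t * log f')` and rescaling joins the identity at `t = 0` to `f` at `t
= 1` (on the circle, up to a rotation). The cocycle distance is Lipschitz along this path, with
constant at most `2 * d f 1`. A Rolle argument makes two diffeomorphisms have equal derivatives
somewhere, and this removes the normalization constants. Being close in cocycle distance (and, on
the circle, agreeing at a point) puts the quotient in a prescribed neighbourhood of the identity.
Cutting the path into `O(d f 1 + 1)` pieces therefore bounds any other continuous right-invariant
pseudometric. The rotations form a compact set and cost only a constant.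

Distortion: with a maximal pseudometric `d` in hand, it depends on whether `d (f ^ n) 1` grows
linearly. At a point fixed by `f ^ q`, the cocycle of `(f ^ q) ^ n` is `n` times that of `f ^ q`, so
a hyperbolic periodic point forces linear growth. Conversely, suppose `log (f ^ n)'` is below `-ε n`
somewhere for arbitrarily large `n`. A Pliss-type selection of records along such an orbit segment
gives many times from which all later partial sums decay exponentially. Two of the corresponding
orbit points are close, so the return map between them contracts a ball of fixed radius into itself,
and its fixed point is a hyperbolic periodic point (`exists_contracting_periodic`). Without
hyperbolic periodic points this applies to `f` and to `f⁻¹`, and yields two-sided uniform sublinear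
growth. -/

noncomputable section

/-! ### Right-invariant pseudometrics and word length -/

namespace IsContRightInvPseudometric

variable {G : Type*} [Group G] [TopologicalSpace G] {d : G → G → ℝ}

theorem nonneg (h : IsContRightInvPseudometric d) (x y : G) : 0 ≤ d x y := by
  have h1 := h.triangle x y x
  rw [h.self_eq_zero, h.symm y x] at h1
  linarith

theorem eq_mul_inv_one (h : IsContRightInvPseudometric d) (x y : G) : d x y = d (x * y⁻¹) 1 := by
  rw [← h.right_inv x y y⁻¹, mul_inv_cancel]

theorem mul_le (h : IsContRightInvPseudometric d) (x y : G) : d (x * y) 1 ≤ d x 1 + d y 1 := by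
  have h1 := h.triangle (x * y) y 1
  have h2 := h.right_inv x 1 y
  rw [one_mul] at h2
  linarith

theorem inv_one_eq (h : IsContRightInvPseudometric d) (x : G) : d x⁻¹ 1 = d x 1 := by
  rw [← h.right_inv x⁻¹ 1 x, inv_mul_cancel, one_mul, h.symm]

theorem list_prod_le (h : IsContRightInvPseudometric d) {B : ℝ} (l : List G)
    (hl : ∀ s ∈ l, d s 1 ≤ B) : d l.prod 1 ≤ B * l.length := by
  induction l with
  | nil => simp [h.self_eq_zero]
  | cons a l ih =>
    have h1 := ih fun s hs => hl s (List.mem_cons_of_mem a hs)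
    have h2 := hl a List.mem_cons_self
    have h3 := h.mul_le a l.prod
    rw [List.prod_cons, List.length_cons]
    push_cast
    linarith

theorem pow_le (h : IsContRightInvPseudometric d) (x : G) (n : ℕ) : d (x ^ n) 1 ≤ d x 1 * n := by
  have := h.list_prod_le (B := d x 1) (List.replicate n x) fun s hs => by
    rw [List.eq_of_mem_replicate hs]
  simpa using this

theorem zpow_eq_natAbs (h : IsContRightInvPseudometric d) (x : G) (n : ℤ) :
    d (x ^ n) 1 = d (x ^ n.natAbs) 1 := by
  rcases Int.natAbs_eq n with hn | hn
  · conv_lhs => rw [hn, zpow_natCast]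
  · conv_lhs => rw [hn, zpow_neg, zpow_natCast, h.inv_one_eq]

theorem chain_le (h : IsContRightInvPseudometric d) {B : ℝ} (γ : ℕ → G)
    (hγ : ∀ i, d (γ (i + 1)) (γ i) ≤ B) (n : ℕ) : d (γ n) (γ 0) ≤ B * n := by
  induction n with
  | zero => simp [h.self_eq_zero]
  | succ n ih =>
    have h1 := h.triangle (γ (n + 1)) (γ n) (γ 0)
    have h2 := hγ n
    push_cast
    linarith

/-- Continuity of a right-invariant pseudometric only has to be checked near the diagonal. -/
theorem of_tendsto (h0 : ∀ x, d x x = 0) (h1 : ∀ x y, d x y = d y x)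
    (h2 : ∀ x y z, d x z ≤ d x y + d y z) (h3 : ∀ x y g, d (x * g) (y * g) = d x y)
    (h4 : ∀ x, ∀ ε > 0, ∀ᶠ y in nhds x, d y x ≤ ε) : IsContRightInvPseudometric d := by
  refine ⟨h0, h1, h2, h3, continuous_iff_continuousAt.2 fun ⟨x, y⟩ => ?_⟩
  rw [ContinuousAt, Metric.tendsto_nhds]
  intro ε hε
  rw [nhds_prod_eq]
  filter_upwards [(h4 x (ε / 3) (by positivity)).prod_mk (h4 y (ε / 3) (by positivity))]
  rintro ⟨x', y'⟩ ⟨hx, hy⟩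
  rw [Real.dist_eq, abs_lt]
  dsimp only at hx hy ⊢
  have e1 := h2 x' x y'
  have e2 := h2 x y y'
  have e3 := h2 x x' y
  have e4 := h2 x' y' y
  rw [h1 x x'] at e3
  rw [h1 y y'] at e2
  constructor <;> linarith

end IsContRightInvPseudometric

/-! ### Word length for a generating set -/

section WordLength

variable {G : Type*} [Group G] {S : Set G}

theorem wordLength_list_prod_le (l : List G) (hl : ∀ s ∈ l, s ∈ S ∨ s⁻¹ ∈ S) :
    wordLength S l.prod ≤ l.length :=
  Nat.sInf_le ⟨l, rfl, hl, rfl⟩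

theorem exists_list_wordLength (hS : Subgroup.closure S = ⊤) (g : G) :
    ∃ l : List G, l.length = wordLength S g ∧ (∀ s ∈ l, s ∈ S ∨ s⁻¹ ∈ S) ∧ l.prod = g := by
  have hg' : g ∈ Submonoid.closure (S ∪ S⁻¹) := by
    rw [← Subgroup.closure_toSubmonoid, hS]
    trivial
  obtain ⟨l, hl, hg⟩ := Submonoid.exists_list_of_mem_closure hg'
  exact Nat.sInf_mem (s := {n : ℕ | ∃ l : List G, l.length = n ∧ (∀ s ∈ l, s ∈ S ∨ s⁻¹ ∈ S) ∧
    l.prod = g}) ⟨_, l, rfl, hl, hg⟩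

theorem wordLength_one : wordLength S (1 : G) = 0 :=
  Nat.le_zero.1 (wordLength_list_prod_le [] (by simp))

theorem wordLength_mul_le (hS : Subgroup.closure S = ⊤) (g h : G) :
    wordLength S (g * h) ≤ wordLength S g + wordLength S h := by
  obtain ⟨l, h1, h2, h3⟩ := exists_list_wordLength hS g
  obtain ⟨m, k1, k2, k3⟩ := exists_list_wordLength hS h
  rw [← h1, ← k1, ← List.length_append]
  conv_lhs => rw [← h3, ← k3, ← List.prod_append]
  exact wordLength_list_prod_le _ fun s hs => (List.mem_append.1 hs).elim (h2 s) (k2 s)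

theorem wordLength_inv_le (hS : Subgroup.closure S = ⊤) (g : G) :
    wordLength S g⁻¹ ≤ wordLength S g := by
  obtain ⟨l, h1, h2, h3⟩ := exists_list_wordLength hS g
  have := wordLength_list_prod_le (S := S) (l.map (·⁻¹)).reverse (by
    intro s hs
    rw [List.mem_reverse, List.mem_map] at hs
    obtain ⟨t, ht, rfl⟩ := hs
    rw [inv_inv]
    exact (h2 t ht).symm)
  rwa [← List.prod_inv_reverse, h3, List.length_reverse, List.length_map, h1] at this

theorem wordLength_pow_le (hS : Subgroup.closure S = ⊤) (g : G) (n : ℕ) :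
    wordLength S (g ^ n) ≤ wordLength S g * n := by
  induction n with
  | zero => simp [wordLength_one]
  | succ n ih =>
    rw [pow_succ, mul_add_one]
    exact (wordLength_mul_le hS _ _).trans (by omega)

theorem wordLength_zpow_le (hS : Subgroup.closure S = ⊤) (g : G) (n : ℤ) :
    wordLength S (g ^ n) ≤ wordLength S g * n.natAbs := by
  rcases Int.natAbs_eq n with hn | hn
  · conv_lhs => rw [hn, zpow_natCast]
    exact wordLength_pow_le hS _ _
  · conv_lhs => rw [hn, zpow_neg, zpow_natCast]
    exact (wordLength_inv_le hS _).trans (wordLength_pow_le hS _ _)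

/-- A word of length `ℓ` in `g` and `g⁻¹` is a power `g ^ k` with `k ≤ ℓ`, and infinite order makes
the exponent unique. -/
theorem le_wordLength_singleton {g : G} (hg : ¬ IsOfFinOrder g)
    (hS : Subgroup.closure {g} = ⊤) (n : ℕ) : n ≤ wordLength {g} (g ^ n) := by
  obtain ⟨l, h1, h2, h3⟩ := exists_list_wordLength hS (g ^ n)
  have key : ∀ l : List G, (∀ s ∈ l, s ∈ ({g} : Set G) ∨ s⁻¹ ∈ ({g} : Set G)) →
      ∃ k : ℤ, k ≤ l.length ∧ l.prod = g ^ k := by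
    intro l
    induction l with
    | nil => exact fun _ => ⟨0, by simp⟩
    | cons a l ih =>
      intro hl
      obtain ⟨k, hk, e⟩ := ih fun s hs => hl s (List.mem_cons_of_mem a hs)
      rw [List.length_cons, List.prod_cons, e]
      push_cast
      rcases hl a List.mem_cons_self with ha | ha
      · rw [mem_singleton_iff.1 ha]
        exact ⟨1 + k, by omega, by rw [zpow_add, zpow_one]⟩
      · rw [mem_singleton_iff, inv_eq_iff_eq_inv] at ha
        rw [ha]
        exact ⟨-1 + k, by omega, by rw [zpow_add, zpow_neg_one]⟩
  obtain ⟨k, hk, e⟩ := key l h2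
  rw [h3, ← zpow_natCast] at e
  have := injective_zpow_iff_not_isOfFinOrder.2 hg e
  omega

end WordLength

/-! ### Growth of powers and distortion of cyclic subgroups -/

section Undistorted

variable {G : Type*} [Group G] [TopologicalSpace G] {d : G → G → ℝ}

/-- Linear growth of the powers for one maximal pseudometric implies undistortion. -/
theorem IsContRightInvPseudometric.not_isDistortedOrTorsion (hd : IsContRightInvPseudometric d)
    {f : G} {c C : ℝ} (hc : 0 < c) (hf : ∀ n : ℕ, c * n - C ≤ d (f ^ n) 1) :
    ¬ IsDistortedOrTorsion f := by
  rw [IsDistortedOrTorsion, not_or, not_not]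
  constructor
  · intro e he S hSfin hS
    -- Since `e` dominates `d`, linear growth passes from `d` to `e`; `d` itself need not be
    -- maximal.
    obtain ⟨K, C', hK⟩ := he.maximal d hd
    have he' := he.toIsContRightInvPseudometric
    obtain ⟨B, hB⟩ := (hSfin.image fun s : Subgroup.zpowers f => e s 1).bddAbove
    have hB' : ∀ s ∈ S, e s 1 ≤ B := fun s hs => hB ⟨s, hs, rfl⟩
    set g : Subgroup.zpowers f := ⟨f, Subgroup.mem_zpowers f⟩ with hg
    set A : ℝ := (wordLength S g : ℝ)
    have hA : 0 ≤ A := Nat.cast_nonneg _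
    have hlow : ∀ x : Subgroup.zpowers f,
        c * (wordLength S x : ℝ) ≤ A * (|K| * e x 1 + |C'| + |C|) := by
      rintro ⟨x, n, hn⟩
      have hx : (⟨x, n, hn⟩ : Subgroup.zpowers f) = g ^ n := by
        ext; rw [Subgroup.coe_zpow]; exact hn.symm
      have h1 : (wordLength S (g ^ n) : ℝ) ≤ A * n.natAbs := by
        simp only [A]
        exact_mod_cast wordLength_zpow_le hS g n
      have h2 := hf n.natAbs
      have h3 := hK (f ^ n) 1
      rw [hd.zpow_eq_natAbs] at h3
      have h4 : K * e (f ^ n) 1 ≤ |K| * e (f ^ n) 1 :=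
        mul_le_mul_of_nonneg_right (le_abs_self K) (he'.nonneg _ _)
      have h5 : ((g ^ n : Subgroup.zpowers f) : G) = f ^ n := by rw [Subgroup.coe_zpow]
      rw [hx, h5]
      calc c * (wordLength S (g ^ n) : ℝ) ≤ c * (A * n.natAbs) := by gcongr
        _ = A * (c * n.natAbs) := by ring
        _ ≤ _ := by
          apply mul_le_mul_of_nonneg_left _ hA
          linarith [le_abs_self C', le_abs_self C]
    have hupp : ∀ x : Subgroup.zpowers f, e x 1 ≤ |B| * wordLength S x := by
      intro x
      obtain ⟨l, h1, h2, h3⟩ := exists_list_wordLength hS x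
      have := he'.list_prod_le (B := |B|) (l.map ((↑) : Subgroup.zpowers f → G)) (by
        intro s hs
        obtain ⟨t, ht, rfl⟩ := List.mem_map.1 hs
        refine le_trans ?_ (le_abs_self B)
        rcases h2 t ht with h | h
        · exact hB' t h
        · have := hB' _ h
          rwa [Subgroup.coe_inv, he'.inv_one_eq] at this)
      rwa [List.length_map, h1, ← Subgroup.val_list_prod, h3] at this
    set Q : ℝ := 1 + |B| + A * |K| / c
    have hQ : 1 ≤ Q := by
      have : 0 ≤ A * |K| / c := by positivity
      have := abs_nonneg B
      linarith
    refine ⟨Q, A * (|C'| + |C|) / c, hQ, by positivity, fun x y => ?_⟩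
    have exy : e x y = e ((x * y⁻¹ : Subgroup.zpowers f) : G) 1 := by
      rw [he'.eq_mul_inv_one, Subgroup.coe_mul, Subgroup.coe_inv]
    rw [cayleyDist]
    generalize x * y⁻¹ = z at exy
    dsimp only
    rw [exy]
    have hz := he'.nonneg (z : G) 1
    have hw : (0 : ℝ) ≤ wordLength S z := Nat.cast_nonneg _
    constructor
    · have h1 := hlow z
      have h2 : (wordLength S z : ℝ) ≤ A * |K| / c * e z 1 + A * (|C'| + |C|) / c := by
        rw [div_mul_eq_mul_div, ← add_div, le_div_iff₀ hc]
        linarith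
      have h3 : A * |K| / c * e z 1 ≤ Q * e z 1 := by
        apply mul_le_mul_of_nonneg_right _ hz
        have := abs_nonneg B
        linarith
      have h4 : (0:ℝ) ≤ A * (|C'| + |C|) / c := by positivity
      have h5 : Q⁻¹ * wordLength S z ≤ Q⁻¹ * (Q * e z 1 + A * (|C'| + |C|) / c) := by
        gcongr; linarith
      have h6 : Q⁻¹ * (A * (|C'| + |C|) / c) ≤ A * (|C'| + |C|) / c :=
        mul_le_of_le_one_left h4 (inv_le_one_of_one_le₀ hQ)
      rw [mul_add, inv_mul_cancel_left₀ (by positivity)] at h5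
      linarith
    · have h1 := hupp z
      have h3 : |B| * wordLength S z ≤ Q * wordLength S z := by
        apply mul_le_mul_of_nonneg_right _ hw
        have : 0 ≤ A * |K| / c := by positivity
        linarith
      have h4 : (0:ℝ) ≤ A * (|C'| + |C|) / c := by positivity
      linarith
  -- If `f ^ m = 1`, the distances `d (f ^ (m * k)) 1` vanish for all `k`, against linear growth as
  -- soon as `c * k > C`.
  · intro h
    obtain ⟨m, hm, hm1⟩ := isOfFinOrder_iff_pow_eq_one.1 h
    obtain ⟨k, hk⟩ := exists_nat_gt (C / c)
    have h1 := hf (m * k)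
    rw [pow_mul, hm1, one_pow, hd.self_eq_zero] at h1
    rw [div_lt_iff₀ hc] at hk
    have h2 : (k : ℝ) ≤ (m * k : ℕ) := by exact_mod_cast Nat.le_mul_of_pos_left k hm
    nlinarith

/-- Linear growth along the powers of `f ^ q` suffices for undistortion. -/
theorem IsContRightInvPseudometric.not_isDistortedOrTorsion_of_pow
    (hd : IsContRightInvPseudometric d) {f : G} {q : ℕ} (hq : 0 < q) {c : ℝ} (hc : 0 < c)
    (hf : ∀ n : ℕ, c * n ≤ d ((f ^ q) ^ n) 1) : ¬ IsDistortedOrTorsion f := by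
  -- Write `n = q * (n / q) + n % q`. The loss `c` pays for rounding `n / q` down, and `d f 1 * q`
  -- pays for the remainder `f ^ (n % q)`.
  refine hd.not_isDistortedOrTorsion (c := c / q) (C := c + d f 1 * q)
    (div_pos hc (Nat.cast_pos.2 hq)) fun n => ?_
  have hq' : (0 : ℝ) < q := Nat.cast_pos.2 hq
  have h1 := hf (n / q)
  have h2 : d ((f ^ q) ^ (n / q)) 1 ≤ d (f ^ n) 1 + d (f ^ (n % q)) 1 := by
    rw [← hd.inv_one_eq (f ^ (n % q))]
    convert hd.mul_le (f ^ n) (f ^ (n % q))⁻¹ using 2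
    rw [eq_mul_inv_iff_mul_eq, ← pow_mul, ← pow_add, Nat.div_add_mod]
  have h3 := hd.pow_le f (n % q)
  have h4 : d f 1 * (n % q : ℕ) ≤ d f 1 * q :=
    mul_le_mul_of_nonneg_left (by exact_mod_cast (Nat.mod_lt n hq).le) (hd.nonneg _ _)
  have h5 : (n : ℝ) / q ≤ (n / q : ℕ) + 1 := by
    rw [div_le_iff₀ hq']
    have : n ≤ (n / q + 1) * q := by
      have := Nat.div_add_mod n q
      have := Nat.mod_lt n hq
      nlinarith
    exact_mod_cast this
  have h6 : c / q * n = c * (n / q) := by ring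
  rw [h6]
  nlinarith

/-- Sublinear growth of the powers for some maximal pseudometric implies distortion. -/
theorem IsMaximalPseudometric.isDistortedOrTorsion (hd : IsMaximalPseudometric d) {f : G}
    (hf : ∀ ε > 0, ∃ N : ℕ, ∀ n ≥ N, d (f ^ n) 1 ≤ ε * n) : IsDistortedOrTorsion f := by
  by_contra hcon
  rw [IsDistortedOrTorsion, not_or, not_not] at hcon
  obtain ⟨hu, ht⟩ := hcon
  set g : Subgroup.zpowers f := ⟨f, Subgroup.mem_zpowers f⟩ with hg
  have hclo : Subgroup.closure {g} = ⊤ := by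
    rw [← Subgroup.zpowers_eq_closure, eq_top_iff]
    rintro ⟨x, n, hn⟩ -
    exact ⟨n, by ext; rw [Subgroup.coe_zpow]; exact hn⟩
  obtain ⟨K, C, hK, hC, h⟩ := hu d hd {g} (finite_singleton g) hclo
  have hgt : ¬ IsOfFinOrder g := fun hh => ht (Submonoid.isOfFinOrder_coe.2 hh)
  have hK0 : 0 < K := by linarith
  -- Half the slope that the quasi-isometric lower bound would force; the remaining half outgrows
  -- the additive constant `C`.
  obtain ⟨N, hN⟩ := hf (K⁻¹ / 2) (by positivity)
  obtain ⟨n, hn⟩ := exists_nat_gt (max (N : ℝ) (C * (2 * K)))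
  rw [max_lt_iff] at hn
  have h1 := (h (g ^ n) 1).1
  have h2 := hN n (by exact_mod_cast hn.1.le)
  have h3 : (n : ℝ) ≤ wordLength {g} (g ^ n) := by
    exact_mod_cast le_wordLength_singleton hgt hclo n
  rw [cayleyDist, inv_one, mul_one] at h1
  have h4 : K⁻¹ * n ≤ K⁻¹ * wordLength {g} (g ^ n) := by gcongr
  have h5 : K⁻¹ / 2 * n ≤ C := by
    change _ ≤ d (f ^ n) 1 at h1
    linarith
  have h6 : (n : ℝ) ≤ C * (2 * K) := by
    calc (n : ℝ) = K⁻¹ / 2 * n * (2 * K) := by field_simp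
      _ ≤ _ := by gcongr
  linarith [hn.2]

end Undistorted

/-! ### Contracting periodic points of one-dimensional maps -/

open Classical in
/-- A sequence with increments at most `B` has many records. -/
theorem le_mul_card_records {T : ℕ → ℝ} {B : ℝ} (hB : 0 ≤ B) (h0 : T 0 ≤ 0)
    (hT : ∀ k, T (k + 1) ≤ T k + B) (k : ℕ) :
    T k ≤ B * ((Finset.Icc 1 k).filter fun j => ∀ i ≤ j, T i ≤ T j).card := by
  induction k using Nat.strong_induction_on with
  | _ k ih =>
    by_cases hrec : ∀ i ≤ k, T i ≤ T k
    · rcases k with _ | k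
      · simpa using h0
      · have h1 := ih k (Nat.lt_succ_self k)
        have h2 : ((Finset.Icc 1 (k + 1)).filter fun j => ∀ i ≤ j, T i ≤ T j).card =
            ((Finset.Icc 1 k).filter fun j => ∀ i ≤ j, T i ≤ T j).card + 1 := by
          rw [← Finset.insert_Icc_right_eq_Icc_add_one (by omega), Finset.filter_insert, if_pos hrec,
            Finset.card_insert_of_notMem (by simp)]
        rw [h2]
        push_cast
        linarith [hT k]
    -- At a non-record some earlier value is larger, so the bound there suffices because the number
    -- of records is monotone.
    · push Not at hrec
      obtain ⟨i, hi, hlt⟩ := hrec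
      have hik : i < k := lt_of_le_of_ne hi (by rintro rfl; exact lt_irrefl _ hlt)
      refine hlt.le.trans ((ih i hik).trans ?_)
      gcongr

theorem hasDerivWithinAt_iterate {X : Set ℝ} {G ψ : ℝ → ℝ} (hG : MapsTo G X X)
    (hd : ∀ x ∈ X, HasDerivWithinAt G (Real.exp (ψ x)) X x) (n : ℕ) {x : ℝ} (hx : x ∈ X) :
    HasDerivWithinAt G^[n] (Real.exp (birkhoffSum G ψ n x)) X x := by
  induction n with
  | zero => simpa using hasDerivWithinAt_id x X
  | succ n ih =>
    rw [Function.iterate_succ', birkhoffSum_succ, add_comm, Real.exp_add]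
    exact (hd _ (hG.iterate n hx)).comp x ih (hG.iterate n)

/-- If the derivatives of the iterates decay exponentially along the orbit of `y`, they do so along
all orbits starting in a ball of controlled radius around `y`. -/
theorem birkhoffSum_le_of_mem_closedBall {X : Set ℝ} (hX : Convex ℝ X) {G ψ : ℝ → ℝ}
    (hG : MapsTo G X X) (hd : ∀ x ∈ X, HasDerivWithinAt G (Real.exp (ψ x)) X x) {c r : ℝ}
    (hc : 0 < c) (hr : 0 < r) (hψ : ∀ x ∈ X, ∀ y ∈ X, |x - y| ≤ r → ψ x ≤ ψ y + c)
    {y : ℝ} (hy : y ∈ X) {m : ℕ} (hm : ∀ j ≤ m, birkhoffSum G ψ j y ≤ -(2 * c * j))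
    {j : ℕ} (hj : j ≤ m) :
    (∀ u ∈ X ∩ Metric.closedBall y r, birkhoffSum G ψ j u ≤ -(c * j)) ∧
    ∀ u ∈ X ∩ Metric.closedBall y r, ∀ v ∈ X ∩ Metric.closedBall y r,
      |G^[j] u - G^[j] v| ≤ Real.exp (-(c * j)) * |u - v| := by
  -- Bootstrap: contraction at all earlier times keeps the orbit of `u` within `r` of that of `y`,
  -- so each term of the sum exceeds that of `y` by at most `c`. This spends half of the decay rate
  -- `2c`. The mean value inequality on the convex ball then gives contraction at time `j`.
  induction j using Nat.strong_induction_on with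
  | _ j ih =>
    have hyb : y ∈ X ∩ Metric.closedBall y r := ⟨hy, Metric.mem_closedBall_self hr.le⟩
    have h1 : ∀ u ∈ X ∩ Metric.closedBall y r, birkhoffSum G ψ j u ≤ -(c * j) := by
      intro u hu
      have h2 : birkhoffSum G ψ j u ≤ birkhoffSum G ψ j y + c * j := by
        have e : c * j = ∑ _i ∈ Finset.range j, c := by simp [mul_comm]
        rw [birkhoffSum, birkhoffSum, e, ← Finset.sum_add_distrib]
        refine Finset.sum_le_sum fun i hi => ?_
        rw [Finset.mem_range] at hi
        refine hψ _ (hG.iterate i hu.1) _ (hG.iterate i hy) ?_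
        refine ((ih i hi (by omega)).2 u hu y hyb).trans ?_
        have h3 : |u - y| ≤ r := by simpa [Real.dist_eq] using hu.2
        have h4 : Real.exp (-(c * i)) ≤ 1 := by
          rw [Real.exp_le_one_iff, neg_nonpos]; positivity
        exact (mul_le_of_le_one_left (abs_nonneg _) h4).trans h3
      linarith [hm j hj]
    refine ⟨h1, fun u hu v hv => ?_⟩
    have := (hX.inter (convex_closedBall y r)).norm_image_sub_le_of_norm_hasDerivWithin_le
      (f := G^[j]) (f' := fun x => Real.exp (birkhoffSum G ψ j x)) (C := Real.exp (-(c * j)))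
      (fun x hx => (hasDerivWithinAt_iterate hG hd j hx.1).mono inter_subset_left)
      (fun x hx => by
        rw [Real.norm_eq_abs, Real.abs_exp, Real.exp_le_exp]; exact h1 x hx) hv hu
    simpa [Real.norm_eq_abs] using this

theorem exists_fixedPoint_of_abs_sub_le {s : Set ℝ} (hs : IsClosed s) {f : ℝ → ℝ}
    (hf : MapsTo f s s) {K : ℝ} (hK0 : 0 ≤ K) (hK : K < 1)
    (h : ∀ u ∈ s, ∀ v ∈ s, |f u - f v| ≤ K * |u - v|) {x : ℝ} (hx : x ∈ s) :
    ∃ z ∈ s, f z = z := by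
  have hcon : ContractingWith ⟨K, hK0⟩ (hf.restrict f s s) := by
    refine ⟨by exact_mod_cast hK, LipschitzWith.of_dist_le_mul fun u v => ?_⟩
    exact h u u.2 v v.2
  obtain ⟨z, hz, hfz, -⟩ := hcon.exists_fixedPoint' hs.isComplete hf hx (edist_ne_top _ _)
  exact ⟨z, hz, hfz⟩

/-- Pigeonhole on the `⌊1 / η⌋ + 1` cells of length `η` that meet `[0, 1]`. -/
theorem exists_lt_mem_abs_sub_le {s : Finset ℕ} {t : ℕ → ℝ} (ht : ∀ j, t j ∈ Icc (0 : ℝ) 1)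
    {η : ℝ} (hη : 0 < η) (hs : 1 / η + 1 < s.card) :
    ∃ i ∈ s, ∃ j ∈ s, i < j ∧ |t i - t j| ≤ η := by
  have h1 : (Finset.range (⌊1 / η⌋₊ + 1)).card < s.card := by
    rw [Finset.card_range]
    have := Nat.floor_le (show 0 ≤ 1 / η by positivity)
    have h2 : ((⌊1 / η⌋₊ + 1 : ℕ) : ℝ) < s.card := by push_cast; linarith
    exact_mod_cast h2
  obtain ⟨i, hi, j, hj, hne, heq⟩ := Finset.exists_ne_map_eq_of_card_lt_of_maps_to h1
    (f := fun k => ⌊t k / η⌋₊) fun k _ => by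
      rw [Finset.coe_range, mem_Iio, Nat.lt_succ_iff]
      exact Nat.floor_le_floor (by gcongr; exact (ht k).2)
  have key : |t i - t j| ≤ η := by
    have e1 := Nat.floor_le (show 0 ≤ t i / η from div_nonneg (ht i).1 hη.le)
    have e2 := Nat.floor_le (show 0 ≤ t j / η from div_nonneg (ht j).1 hη.le)
    have e3 := Nat.lt_floor_add_one (t i / η)
    have e4 := Nat.lt_floor_add_one (t j / η)
    rw [heq] at e1 e3
    have : |t i / η - t j / η| ≤ 1 := by rw [abs_le]; constructor <;> linarith
    rwa [← sub_div, abs_div, abs_of_pos hη, div_le_one hη] at this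
  rcases hne.lt_or_gt with h | h
  · exact ⟨i, hi, j, hj, h, key⟩
  · exact ⟨j, hj, i, hi, h, by rwa [abs_sub_comm]⟩

/-- A one-dimensional `C¹` map whose iterates have derivatives that decay exponentially along
arbitrarily long orbit segments has a contracting periodic point. -/
theorem exists_contracting_periodic {X : Set ℝ} (hX : Convex ℝ X) (hXc : IsClosed X)
    {A : AddSubgroup ℝ} (hA : ∀ a ∈ A, ∀ x ∈ X, x + a ∈ X)
    (hA1 : ∀ x ∈ X, ∃ a ∈ A, x + a ∈ Icc (0 : ℝ) 1) {G ψ : ℝ → ℝ} (hG : MapsTo G X X)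
    (hd : ∀ x ∈ X, HasDerivWithinAt G (Real.exp (ψ x)) X x) (hψ : UniformContinuousOn ψ X)
    {B : ℝ} (hB : 0 < B) (hψB : ∀ x ∈ X, -B ≤ ψ x) {c : ℝ} (hc : 0 < c)
    (h : ∀ N : ℕ, ∃ n ≥ N, ∃ x ∈ X, birkhoffSum G ψ n x ≤ -(4 * c * n)) :
    ∃ n > 0, ∃ z ∈ X, z - G^[n] z ∈ A ∧ birkhoffSum G ψ n z < 0 := by
  classical
  obtain ⟨r', hr', hψr'⟩ := Metric.uniformContinuousOn_iff.1 hψ c hc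
  obtain ⟨r, hr, hψr⟩ : ∃ r > 0, ∀ x ∈ X, ∀ y ∈ X, |x - y| ≤ r → ψ x ≤ ψ y + c := by
    refine ⟨r' / 2, by positivity, fun x hx y hy hxy => ?_⟩
    have := hψr' x hx y hy (by rw [Real.dist_eq]; linarith)
    rw [Real.dist_eq] at this
    linarith [(abs_lt.1 this).2]
  set K := Real.exp (-c) with hK
  have hK1 : K < 1 := by rw [hK, Real.exp_lt_one_iff]; linarith
  have hK0 : 0 < K := Real.exp_pos _
  -- A `K`-contraction that moves the centre of a ball of radius `r` by at most `(1 - K) * r` maps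
  -- the ball into itself.
  set η := (1 - K) * r with hη
  have hη0 : 0 < η := mul_pos (by linarith) hr
  obtain ⟨N, hN⟩ := exists_nat_gt ((1 / η + 1) * B / (2 * c))
  obtain ⟨n, hn, x, hx, hsum⟩ := h N
  -- Tilting by `2c` turns "exponential decay at rate `2c` from time `k` on" into "`V` never again
  -- exceeds `V k`". Of the rate `4c`, half is left over, so `V n ≤ -2cn`.
  set V : ℕ → ℝ := fun k => birkhoffSum G ψ k x + 2 * c * k with hV
  have hVstep : ∀ k, V k ≤ V (k + 1) + B := by
    intro k
    have := hψB _ (hG.iterate k hx)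
    simp only [hV, birkhoffSum_succ]
    push_cast
    linarith
  -- Time is reversed: a record `j` of `T` is a time `n - j` from which `V` stays below its value
  -- there up to time `n`. Truncated subtraction makes `T` constant beyond `n`, so the increment
  -- bound holds for every `k`.
  set T : ℕ → ℝ := fun k => V (n - k) - V n with hT
  have hTn := le_mul_card_records (T := T) hB.le (by simp [hT]) (fun k => by
    simp only [hT]
    rcases Nat.lt_or_ge k n with hk | hk
    · have := hVstep (n - (k + 1))
      rw [show n - (k + 1) + 1 = n - k by omega] at this
      linarith
    · rw [show n - (k + 1) = n - k by omega]
      linarith) n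
  set R := (Finset.Icc 1 n).filter fun j => ∀ i ≤ j, T i ≤ T j with hR
  have hcard : 1 / η + 1 < R.card := by
    have h1 : T n = -birkhoffSum G ψ n x - 2 * c * n := by simp [hT, hV]; ring
    rw [h1] at hTn
    have h2 : (N : ℝ) ≤ n := by exact_mod_cast hn
    rw [div_lt_iff₀ (by positivity)] at hN
    have h3 : (1 / η + 1) * B < R.card * B := by nlinarith
    exact lt_of_mul_lt_mul_right h3 hB.le
  choose! a haA ha using hA1
  -- Two record times whose orbit points, moved into `[0, 1]` by elements of `A`, are `η`-close. The
  -- earlier orbit point, `y`, belongs to the larger index `j`, and `G^[m]` carries it to the other.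
  obtain ⟨i, hi, j, hj, hij, hdist⟩ := exists_lt_mem_abs_sub_le (s := R)
    (t := fun k => G^[n - k] x + a (G^[n - k] x)) (fun k => ha _ (hG.iterate _ hx)) hη0 hcard
  rw [hR, Finset.mem_filter, Finset.mem_Icc] at hi hj
  set y := G^[n - j] x with hy
  have hyX : y ∈ X := hG.iterate _ hx
  set m := j - i with hm
  have hGm : G^[n - i] x = G^[m] y := by
    rw [hy, ← Function.iterate_add_apply, show m + (n - j) = n - i by omega]
  -- The record property of `j` compared with `j - k`.
  have hgood : ∀ k ≤ m, birkhoffSum G ψ k y ≤ -(2 * c * k) := by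
    intro k hk
    have h1 := hj.2 (j - k) (by omega)
    simp only [hT, hV] at h1
    rw [show n - (j - k) = (n - j) + k by omega, birkhoffSum_add] at h1
    push_cast at h1
    linarith
  obtain ⟨hS, hLip⟩ := birkhoffSum_le_of_mem_closedBall hX hG hd hc hr hψr hyX hgood le_rfl
  set b := a (G^[n - i] x) - a y with hb
  have hbA : b ∈ A := A.sub_mem (haA _ (hG.iterate _ hx)) (haA _ hyX)
  have hm1 : (1 : ℝ) ≤ m := by
    have : 1 ≤ m := by omega
    exact_mod_cast this
  have hLip' : ∀ u ∈ X ∩ Metric.closedBall y r, ∀ v ∈ X ∩ Metric.closedBall y r,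
      |(G^[m] u + b) - (G^[m] v + b)| ≤ K * |u - v| := by
    intro u hu v hv
    rw [add_sub_add_right_eq_sub]
    refine (hLip u hu v hv).trans ?_
    gcongr
    rw [hK, Real.exp_le_exp]
    nlinarith
  have hyb : y ∈ X ∩ Metric.closedBall y r := ⟨hyX, Metric.mem_closedBall_self hr.le⟩
  have hmaps : MapsTo (fun u => G^[m] u + b) (X ∩ Metric.closedBall y r)
      (X ∩ Metric.closedBall y r) := by
    intro u hu
    refine ⟨hA b hbA _ (hG.iterate m hu.1), ?_⟩
    have h1 := hLip' u hu y hyb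
    have h2 : |u - y| ≤ r := by simpa [Real.dist_eq] using hu.2
    have h3 : |G^[m] y + b - y| ≤ η := by
      rw [← hGm, hb]
      convert hdist using 2
      ring
    have h4 : K * |u - y| ≤ K * r := by gcongr
    rw [Metric.mem_closedBall, Real.dist_eq]
    calc |G^[m] u + b - y| ≤ |(G^[m] u + b) - (G^[m] y + b)| + |G^[m] y + b - y| :=
          abs_sub_le _ _ _
      _ ≤ r := by rw [hη] at h3; linarith
  obtain ⟨z, hz, hfz⟩ := exists_fixedPoint_of_abs_sub_le (hXc.inter Metric.isClosed_closedBall)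
    hmaps hK0.le hK1 hLip' hyb
  refine ⟨m, by omega, z, hz.1, ?_, (hS z hz).trans_lt (by rw [neg_lt_zero]; positivity)⟩
  convert hbA using 1
  exact sub_eq_of_eq_add' hfz.symm

/-! ### Groups of transformations with a logarithmic derivative -/

/-- The `C¹` topology in `ε` form. The topology enters through the equation `ht`, so that one
statement serves both groups. -/
theorem mem_nhds_induced_uniformFun {G M : Type*} [PseudoMetricSpace M] [TopologicalSpace G]
    {e : G → M → M} {D : G → M → ℝ}
    (ht : ‹TopologicalSpace G› = TopologicalSpace.induced
      (fun f => (UniformFun.ofFun (e f), UniformFun.ofFun (D f))) inferInstance)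
    {g : G} {U : Set G} :
    U ∈ nhds g ↔ ∃ ε > 0, ∀ h, (∀ x, dist (e h x) (e g x) < ε) →
      (∀ x, |D h x - D g x| < ε) → h ∈ U := by
  have hb := (((UniformFun.hasBasis_nhds_of_basis M M (UniformFun.ofFun (e g))
    Metric.uniformity_basis_dist).prod_nhds (UniformFun.hasBasis_nhds_of_basis M ℝ
      (UniformFun.ofFun (D g)) Metric.uniformity_basis_dist)).comap
        fun f => (UniformFun.ofFun (e f), UniformFun.ofFun (D f)))
  rw [← nhds_induced, ← ht] at hb
  rw [hb.mem_iff]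
  constructor
  · rintro ⟨⟨ε, δ⟩, ⟨h1, h2⟩, h3⟩
    refine ⟨min ε δ, lt_min h1 h2, fun h k1 k2 => h3 ⟨fun x => ?_, fun x => ?_⟩⟩
    · exact (dist_comm _ _).trans_lt ((k1 x).trans_le (min_le_left _ _))
    · exact (dist_comm _ _).trans_lt ((k2 x).trans_le (min_le_right _ _))
  · rintro ⟨ε, h1, h2⟩
    refine ⟨(ε, ε), ⟨h1, h1⟩, fun h hh => h2 h (fun x => ?_) fun x => ?_⟩
    · exact (dist_comm _ _).trans_lt (hh.1 x)
    · exact (dist_comm _ _).trans_lt (hh.2 x)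

/-- Uniform continuity of `log` away from `0`, from `log t ≤ t - 1` applied to both `b / a` and `a /
b`. -/
theorem exists_abs_log_sub_log_le {m ε : ℝ} (hm : 0 < m) (hε : 0 < ε) :
    ∃ δ > 0, ∀ a b : ℝ, m ≤ a → |b - a| < δ → |Real.log b - Real.log a| ≤ ε := by
  refine ⟨min (m / 2) (m / 2 * ε), by positivity, fun a b ha hab => ?_⟩
  rw [lt_min_iff] at hab
  obtain ⟨h1, h2⟩ := hab
  have hb : m / 2 ≤ b := by linarith [(abs_lt.1 h1).1]
  have ha0 : 0 < a := by linarith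
  have hb0 : 0 < b := by linarith
  have h3 := Real.log_le_sub_one_of_pos (div_pos hb0 ha0)
  have h4 := Real.log_le_sub_one_of_pos (div_pos ha0 hb0)
  rw [Real.log_div hb0.ne' ha0.ne'] at h3
  rw [Real.log_div ha0.ne' hb0.ne'] at h4
  have h5 : b / a - 1 ≤ ε := by
    rw [div_sub_one ha0.ne', div_le_iff₀ ha0]
    nlinarith [(abs_lt.1 h2).2]
  have h6 : a / b - 1 ≤ ε := by
    rw [div_sub_one hb0.ne', div_le_iff₀ hb0]
    nlinarith [(abs_lt.1 h2).1]
  rw [abs_le]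
  constructor <;> linarith

/-! ### Bounded cocycles and their pseudometrics -/

section Cocycle

variable {G M : Type*} [Group G] {e : G → M → M} {c : G → M → ℝ}

/-- `c` is a bounded additive cocycle over the action `e`. -/
structure IsBoundedCocycle (e : G → M → M) (c : G → M → ℝ) : Prop where
  act_one : ∀ x, e 1 x = x
  act_mul : ∀ f g x, e (f * g) x = e f (e g x)
  map_mul : ∀ f g x, c (f * g) x = c f (e g x) + c g x
  bounded : ∀ f, ∃ B, ∀ x, |c f x| ≤ B

namespace IsBoundedCocycle

theorem surjective (h : IsBoundedCocycle e c) (g : G) : Function.Surjective (e g) := fun x =>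
  ⟨e g⁻¹ x, by rw [← h.act_mul, mul_inv_cancel, h.act_one]⟩

theorem map_one (h : IsBoundedCocycle e c) (x : M) : c 1 x = 0 := by
  have := h.map_mul 1 1 x
  rw [mul_one, h.act_one] at this
  linarith

theorem map_inv (h : IsBoundedCocycle e c) (f : G) (x : M) : c f⁻¹ (e f x) = -c f x := by
  have := h.map_mul f⁻¹ f x
  rw [inv_mul_cancel, h.map_one] at this
  linarith

/-- Turns closeness of the cocycles of `f` and `g` into smallness of the cocycle of `f * g⁻¹`, hence
into nearness to the identity. -/
theorem map_mul_inv (h : IsBoundedCocycle e c) (f g : G) (x : M) :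
    c (f * g⁻¹) (e g x) = c f x - c g x := by
  rw [h.map_mul, h.map_inv, ← h.act_mul, inv_mul_cancel, h.act_one, sub_eq_add_neg]

theorem map_pow (h : IsBoundedCocycle e c) (f : G) (n : ℕ) (x : M) :
    c (f ^ n) x = birkhoffSum (e f) (c f) n x := by
  induction n generalizing x with
  | zero => simp [h.map_one]
  | succ n ih => rw [pow_succ, h.map_mul, ih, birkhoffSum_succ', add_comm]

theorem act_pow (h : IsBoundedCocycle e c) (f : G) (n : ℕ) (x : M) :
    e (f ^ n) x = (e f)^[n] x := by
  induction n with
  | zero => simp [h.act_one]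
  | succ n ih => rw [pow_succ', h.act_mul, ih, Function.iterate_succ_apply']

theorem map_pow_of_fixed (h : IsBoundedCocycle e c) {f : G} {x : M} (hx : e f x = x) (n : ℕ) :
    c (f ^ n) x = n * c f x := by
  induction n with
  | zero => simp [h.map_one]
  | succ n ih => rw [pow_succ, h.map_mul, hx, ih]; push_cast; ring

/-- The pseudometric associated with a bounded cocycle. -/
def _root_.cocycleDist (c : G → M → ℝ) (f g : G) : ℝ := ⨆ x, |c f x - c g x|

theorem bddAbove (h : IsBoundedCocycle e c) (f g : G) :
    BddAbove (range fun x => |c f x - c g x|) := by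
  obtain ⟨A, hA⟩ := h.bounded f
  obtain ⟨B, hB⟩ := h.bounded g
  refine ⟨A + B, ?_⟩
  rintro _ ⟨x, rfl⟩
  exact (abs_sub _ _).trans (add_le_add (hA x) (hB x))

theorem abs_sub_le (h : IsBoundedCocycle e c) (f g : G) (x : M) :
    |c f x - c g x| ≤ cocycleDist c f g := le_ciSup (h.bddAbove f g) x

theorem abs_le (h : IsBoundedCocycle e c) (f : G) (x : M) :
    |c f x| ≤ cocycleDist c f 1 := by
  simpa [h.map_one] using h.abs_sub_le f 1 x

theorem isContRightInvPseudometric [TopologicalSpace G] [Nonempty M] (h : IsBoundedCocycle e c)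
    (hcont : ∀ f, ∀ ε > 0, ∀ᶠ g in nhds f, ∀ x, |c g x - c f x| ≤ ε) :
    IsContRightInvPseudometric (cocycleDist c) := by
  refine .of_tendsto (fun x => by simp [cocycleDist])
    (fun x y => by simp only [cocycleDist, abs_sub_comm]) (fun f g k => ?_) (fun f g k => ?_)
    fun f ε hε => ?_
  · refine ciSup_le fun x => (_root_.abs_sub_le _ (c g x) _).trans ?_
    exact add_le_add (h.abs_sub_le _ _ x) (h.abs_sub_le _ _ x)
  · simp only [cocycleDist, h.map_mul, add_sub_add_right_eq_sub]
    -- Right translation by `k` only reparametrizes the supremum by the surjection `e k`.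
    exact (h.surjective k).iSup_comp fun y => |c f y - c g y|
  · filter_upwards [hcont f ε hε] with g hg
    exact ciSup_le hg

/-- A lower bound for the growth of the cocycle along the powers of `f` and of `f⁻¹` gives a bound
for its absolute value. -/
theorem abs_map_pow_le (h : IsBoundedCocycle e c) {f : G} {ε : ℝ}
    (h1 : ∃ N : ℕ, ∀ n ≥ N, ∀ x, -(ε * n) ≤ c (f ^ n) x)
    (h2 : ∃ N : ℕ, ∀ n ≥ N, ∀ x, -(ε * n) ≤ c (f⁻¹ ^ n) x) :
    ∃ N : ℕ, ∀ n ≥ N, ∀ x, |c (f ^ n) x| ≤ ε * n := by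
  obtain ⟨N, hN⟩ := h1
  obtain ⟨N', hN'⟩ := h2
  refine ⟨max N N', fun n hn x => _root_.abs_le.2
    ⟨hN n (le_of_max_le_left hn) x, ?_⟩⟩
  -- The cocycle of `f ^ (-n)` at the endpoint of the orbit segment is minus that of `f ^ n` at its
  -- start.
  have := hN' n (le_of_max_le_right hn) (e (f ^ n) x)
  rw [inv_pow, h.map_inv] at this
  linarith

end IsBoundedCocycle

end Cocycle

/-- The maximality criterion: every element can be joined to the identity, up to bounded error, by
a path along which the cocycle distance is Lipschitz. -/
theorem IsContRightInvPseudometric.isMaximalPseudometric {G : Type*} [Group G]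
    [TopologicalSpace G] {d : G → G → ℝ} (hd : IsContRightInvPseudometric d)
    (h : ∀ ρ : G → G → ℝ, IsContRightInvPseudometric ρ → ∃ δ > 0, ∃ C, ∀ f, ∃ γ : ℝ → G,
      (∀ s t, 2 * (|s - t| * d f 1) ≤ δ → ρ (γ s) (γ t) ≤ 1) ∧
        ρ f (γ 1) ≤ C ∧ ρ (γ 0) 1 ≤ C) :
    IsMaximalPseudometric d := by
  refine ⟨hd, fun ρ hρ => ?_⟩
  obtain ⟨δ, hδ, C, hC⟩ := h ρ hρ
  have key : ∀ f, ρ f 1 ≤ 2 / δ * d f 1 + (2 * C + 1) := by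
    intro f
    obtain ⟨γ, h1, h2, h3⟩ := hC f
    have hd0 := hd.nonneg f 1
    -- Enough equal steps to make `2 * (d f 1 / N) ≤ δ`, so each step has `ρ`-length at most `1`;
    -- the `+ 1` keeps `N` positive.
    set N := ⌊2 / δ * d f 1⌋₊ + 1 with hN
    have hN1 : (N : ℝ) ≤ 2 / δ * d f 1 + 1 := by
      rw [hN]; push_cast
      gcongr
      exact Nat.floor_le (by positivity)
    have hN2 : 2 / δ * d f 1 ≤ N := by
      rw [hN]; push_cast; exact (Nat.lt_floor_add_one _).le
    have hN0 : (0 : ℝ) < N := by rw [hN]; positivity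
    have h4 := hρ.chain_le (B := 1) (fun i => γ (i / N)) (fun i => by
      refine h1 _ _ ?_
      rw [← sub_div, Nat.cast_add_one, add_sub_cancel_left, abs_of_pos (by positivity),
        ← mul_assoc, ← mul_div_assoc, mul_one, div_mul_eq_mul_div, div_le_iff₀ hN0]
      rw [div_mul_eq_mul_div, div_le_iff₀ hδ] at hN2
      linarith) N
    rw [div_self hN0.ne', Nat.cast_zero, zero_div] at h4
    have h5 := hρ.triangle f (γ 1) 1
    have h6 := hρ.triangle (γ 1) (γ 0) 1
    linarith
  refine ⟨2 / δ, 2 * C + 1, fun x y => ?_⟩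
  rw [hρ.eq_mul_inv_one, hd.eq_mul_inv_one x y]
  exact key _

/-- A positive continuous density bounded away from zero integrates to a `C¹` diffeomorphism of
the line. -/
theorem exists_homeomorph_of_density {p : ℝ → ℝ} (hp : Continuous p) {m : ℝ} (hm : 0 < m)
    (hpm : ∀ x, m ≤ p x) : ∃ e : ℝ ≃ₜ ℝ, (∀ x, e x = ∫ t in (0 : ℝ)..x, p t) ∧ StrictMono e ∧
      (∀ x, HasDerivAt e (p x) x) ∧ ContDiff ℝ 1 e ∧ ContDiff ℝ 1 e.symm := by
  set P : ℝ → ℝ := fun x => ∫ t in (0 : ℝ)..x, p t with hP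
  have hderiv : ∀ x, HasDerivAt P (p x) x := fun x => (hp.integral_hasStrictDerivAt 0 x).hasDerivAt
  have hcd : ContDiff ℝ 1 P := by
    rw [contDiff_one_iff_deriv]
    refine ⟨fun x => (hderiv x).differentiableAt, ?_⟩
    rwa [show deriv P = p from funext fun x => (hderiv x).deriv]
  have hmono : StrictMono P := strictMono_of_deriv_pos fun x => by
    rw [(hderiv x).deriv]; exact hm.trans_le (hpm x)
  -- Growth at least linear with slope `m` makes `P` unbounded in both directions, hence surjective.
  have hmono' : Monotone fun x => P x - m * x := by
    refine monotone_of_deriv_nonneg (fun x => ?_) fun x => ?_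
    · exact ((hderiv x).sub ((hasDerivAt_id x).const_mul m)).differentiableAt
    · have := ((hderiv x).sub ((hasDerivAt_id x).const_mul m)).deriv
      erw [this]
      linarith [hpm x]
  have hP0 : P 0 = 0 := by simp [hP]
  have hsurj : Function.Surjective P := by
    refine hcd.continuous.surjective ?_ ?_
    · refine Filter.tendsto_atTop_mono' _ ?_ (Filter.tendsto_id.const_mul_atTop hm)
      filter_upwards [Filter.eventually_ge_atTop 0] with x hx
      have := hmono' hx
      simp only [hP0] at this
      simp only [id]
      linarith
    · refine Filter.tendsto_atBot_mono' _ ?_ (Filter.tendsto_id.const_mul_atBot hm)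
      filter_upwards [Filter.eventually_le_atBot 0] with x hx
      have := hmono' hx
      simp only [hP0] at this
      simp only [id]
      linarith
  set e : ℝ ≃ₜ ℝ := (hmono.orderIsoOfSurjective P hsurj).toHomeomorph with he
  refine ⟨e, fun x => rfl, hmono, hderiv, hcd, ?_⟩
  exact e.contDiff_symm_deriv (f' := p) (fun x => (hm.trans_le (hpm x)).ne') hderiv hcd

/-- Every bounded continuous function is, up to an additive constant, the logarithmic derivative of
a `C¹` diffeomorphism of the line which fixes `0` and `1`. -/
theorem exists_homeomorph_of_log_deriv {φ : ℝ → ℝ} (hφ : Continuous φ) {B : ℝ}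
    (hB : ∀ x, |φ x| ≤ B) : ∃ (e : ℝ ≃ₜ ℝ) (k : ℝ), e 0 = 0 ∧ e 1 = 1 ∧ StrictMono e ∧
      (∀ x, HasDerivAt e (Real.exp (φ x - k)) x) ∧ ContDiff ℝ 1 e ∧ ContDiff ℝ 1 e.symm := by
  set J := ∫ t in (0 : ℝ)..1, Real.exp (φ t) with hJ
  have hc : Continuous fun t => Real.exp (φ t) := Real.continuous_exp.comp hφ
  have hJ0 : 0 < J := intervalIntegral.intervalIntegral_pos_of_pos (hc.intervalIntegrable _ _)
    (fun t => Real.exp_pos _) one_pos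
  obtain ⟨e, h1, h2, h3, h4, h5⟩ := exists_homeomorph_of_density
    (p := fun t => Real.exp (φ t - Real.log J)) (by fun_prop)
    (m := Real.exp (-B - Real.log J)) (Real.exp_pos _) fun x => by
      rw [Real.exp_le_exp]; linarith [(abs_le.1 (hB x)).1]
  -- Subtracting `log J` divides the density by its integral over `[0, 1]`, so that `e 1 = 1`.
  refine ⟨e, Real.log J, by simp [h1], ?_, h2, h3, h4, h5⟩
  simp only [h1, Real.exp_sub, Real.exp_log hJ0, intervalIntegral.integral_div]
  exact div_self hJ0.ne'

theorem birkhoffSum_comp_semiconj {α β : Type*} {π : α → β} {f : α → α} {g : β → β}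
    (h : Function.Semiconj π f g) (φ : β → ℝ) (n : ℕ) (x : α) :
    birkhoffSum f (φ ∘ π) n x = birkhoffSum g φ n (π x) :=
  Finset.sum_congr rfl fun k _ => congrArg φ ((h.iterate_right k).eq x)

theorem exists_pos_forall_abs_le_log_imp {ε : ℝ} (hε : 0 < ε) :
    ∃ δ > 0, ∀ a : ℝ, 0 < a → |Real.log a| ≤ δ → |a - 1| < ε := by
  obtain ⟨δ, hδ, h⟩ := Metric.continuousAt_iff.1 (Real.continuous_exp.continuousAt (x := 0)) ε hε
  refine ⟨δ / 2, by positivity, fun a ha hla => ?_⟩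
  have := h (x := Real.log a) (by rw [Real.dist_eq, sub_zero]; linarith)
  rwa [Real.exp_log ha, Real.exp_zero, Real.dist_eq] at this

/-! ### Diffeomorphisms of the interval -/

namespace IntervalDiff

theorem act_mul (f g : IntervalDiff) (x : unitInterval) : (f * g) x = f (g x) := rfl

theorem act_one (x : unitInterval) : (1 : IntervalDiff) x = x := rfl

theorem act_zero (f : IntervalDiff) : f 0 = 0 := by
  have h : f (f.1.symm 0) = 0 := f.1.apply_symm_apply 0
  exact le_antisymm ((f.2.1.monotone unitInterval.nonneg').trans_eq h) unitInterval.nonneg'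

theorem act_top (f : IntervalDiff) : f 1 = 1 := by
  have h : f (f.1.symm 1) = 1 := f.1.apply_symm_apply 1
  exact le_antisymm unitInterval.le_one' (h.symm.trans_le (f.2.1.monotone unitInterval.le_one'))

theorem hasDerivWithinAt (f : IntervalDiff) (x : unitInterval) :
    HasDerivWithinAt (intervalExtend f) (f.deriv x) (Icc 0 1) x :=
  ((f.2.2.1.differentiableOn one_ne_zero) x x.2).hasDerivWithinAt

theorem uniqueDiffWithinAt (x : unitInterval) : UniqueDiffWithinAt ℝ (Icc (0 : ℝ) 1) x :=
  uniqueDiffOn_Icc zero_lt_one x x.2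

theorem deriv_eq {f : IntervalDiff} {x : unitInterval} {a : ℝ}
    (h : HasDerivWithinAt (intervalExtend f) a (Icc 0 1) x) : f.deriv x = a :=
  h.derivWithin (uniqueDiffWithinAt x)

theorem mapsTo_intervalExtend (f : IntervalDiff) :
    MapsTo (intervalExtend f) (Icc 0 1) (Icc 0 1) := fun x hx => by
  rw [intervalExtend_coe f ⟨x, hx⟩]; exact (f ⟨x, hx⟩).2

theorem deriv_mul (f g : IntervalDiff) (x : unitInterval) :
    (f * g).deriv x = f.deriv (g x) * g.deriv x := by
  refine deriv_eq ?_
  have h1 := f.hasDerivWithinAt (g x)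
  rw [← intervalExtend_coe] at h1
  refine (h1.comp (x : ℝ) (g.hasDerivWithinAt x) g.mapsTo_intervalExtend).congr (fun y hy => ?_) ?_
  · rw [Function.comp_apply, intervalExtend_coe g ⟨y, hy⟩, intervalExtend_coe,
      intervalExtend_coe _ ⟨y, hy⟩, act_mul]
  · rw [Function.comp_apply, intervalExtend_coe, intervalExtend_coe, intervalExtend_coe, act_mul]

theorem deriv_one (x : unitInterval) : (1 : IntervalDiff).deriv x = 1 := by
  refine deriv_eq ((hasDerivWithinAt_id (x : ℝ) _).congr (fun y hy => ?_) ?_)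
  · exact intervalExtend_coe _ ⟨y, hy⟩
  · exact intervalExtend_coe _ _

theorem deriv_pos (f : IntervalDiff) (x : unitInterval) : 0 < f.deriv x := by
  have h1 : f⁻¹.deriv (f x) * f.deriv x = 1 := by rw [← deriv_mul, inv_mul_cancel, deriv_one]
  have hmono : Monotone (intervalExtend f) := by
    intro a b hab
    exact f.2.1.monotone (monotone_projIcc _ hab)
  have h2 : 0 ≤ f.deriv x := (hmono.monotoneOn _).derivWithin_nonneg
  -- Monotonicity gives a nonnegative derivative, and the chain rule with the inverse excludes zero.
  exact lt_of_le_of_ne h2 fun h => by rw [← h, mul_zero] at h1; exact zero_ne_one h1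

theorem continuous_deriv (f : IntervalDiff) : Continuous f.deriv :=
  continuousOn_iff_continuous_domRestrict.1
    (f.2.2.1.continuousOn_derivWithin (uniqueDiffOn_Icc zero_lt_one) le_rfl)

/-- The logarithmic derivative. -/
def logDeriv (f : IntervalDiff) (x : unitInterval) : ℝ := Real.log (f.deriv x)

theorem exp_logDeriv (f : IntervalDiff) (x : unitInterval) : Real.exp (f.logDeriv x) = f.deriv x :=
  Real.exp_log (f.deriv_pos x)

theorem continuous_logDeriv (f : IntervalDiff) : Continuous f.logDeriv :=
  f.continuous_deriv.log fun x => (f.deriv_pos x).ne'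

theorem logDeriv_mul (f g : IntervalDiff) (x : unitInterval) :
    (f * g).logDeriv x = f.logDeriv (g x) + g.logDeriv x := by
  rw [logDeriv, deriv_mul, Real.log_mul (f.deriv_pos _).ne' (g.deriv_pos _).ne']; rfl

theorem exists_abs_le_of_continuous {φ : unitInterval → ℝ} (hφ : Continuous φ) :
    ∃ B, ∀ x, |φ x| ≤ B := by
  obtain ⟨B, hB⟩ := isCompact_univ.exists_bound_of_continuousOn hφ.continuousOn
  exact ⟨B, fun x => hB x (mem_univ x)⟩

theorem isBoundedCocycle_logDeriv :
    IsBoundedCocycle (fun f : IntervalDiff => (f : unitInterval → unitInterval)) logDeriv :=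
  ⟨act_one, act_mul, logDeriv_mul, fun f => exists_abs_le_of_continuous f.continuous_logDeriv⟩

/-- The logarithmic derivative normalized at the left endpoint. -/
def relLogDeriv (f : IntervalDiff) (x : unitInterval) : ℝ := f.logDeriv x - f.logDeriv 0

theorem isBoundedCocycle_relLogDeriv :
    IsBoundedCocycle (fun f : IntervalDiff => (f : unitInterval → unitInterval)) relLogDeriv := by
  refine ⟨act_one, act_mul, fun f g x => ?_, fun f =>
    exists_abs_le_of_continuous (f.continuous_logDeriv.sub continuous_const)⟩
  simp only [relLogDeriv, logDeriv_mul, act_zero]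
  ring

theorem logDist_eq : logDist = cocycleDist relLogDeriv := rfl

theorem mem_nhds_iff {g : IntervalDiff} {U : Set IntervalDiff} :
    U ∈ nhds g ↔ ∃ ε > 0, ∀ h : IntervalDiff, (∀ x, dist (h x) (g x) < ε) →
      (∀ x, |h.deriv x - g.deriv x| < ε) → h ∈ U :=
  mem_nhds_induced_uniformFun (e := fun f : IntervalDiff => (f : unitInterval → unitInterval))
    (D := deriv) rfl

/-! ### Interval: continuity and maximality of the logarithmic distance -/

theorem exists_pos_le_deriv (f : IntervalDiff) : ∃ m > 0, ∀ x, m ≤ f.deriv x := by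
  obtain ⟨x, -, hx⟩ := isCompact_univ.exists_isMinOn univ_nonempty f.continuous_deriv.continuousOn
  exact ⟨f.deriv x, f.deriv_pos x, fun y => hx (mem_univ y)⟩

theorem eventually_abs_logDeriv_sub_le (f : IntervalDiff) {ε : ℝ} (hε : 0 < ε) :
    ∀ᶠ g in nhds f, ∀ x, |g.logDeriv x - f.logDeriv x| ≤ ε := by
  obtain ⟨m, hm, hfm⟩ := f.exists_pos_le_deriv
  obtain ⟨δ, hδ, h⟩ := exists_abs_log_sub_log_le hm hε
  exact mem_nhds_iff.2 ⟨δ, hδ, fun g _ hg x => h _ _ (hfm x) (hg x)⟩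

theorem isContRightInvPseudometric_logDist :
    IsContRightInvPseudometric logDist := by
  rw [logDist_eq]
  refine isBoundedCocycle_relLogDeriv.isContRightInvPseudometric fun f ε hε => ?_
  filter_upwards [f.eventually_abs_logDeriv_sub_le (half_pos hε)] with g hg x
  have h1 := abs_le.1 (hg x)
  have h2 := abs_le.1 (hg 0)
  rw [relLogDeriv, relLogDeriv, abs_le]
  constructor <;> linarith

/-- Rolle's theorem for the difference, which vanishes at both endpoints. -/
theorem exists_deriv_eq (f g : IntervalDiff) : ∃ x, f.deriv x = g.deriv x := by
  have hcont : ∀ f : IntervalDiff, ContinuousOn (intervalExtend f) (Icc 0 1) :=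
    fun f => f.2.2.1.continuousOn
  have h0 : ∀ f : IntervalDiff, intervalExtend f 0 = 0 := fun f => by
    have := intervalExtend_coe f 0
    rwa [act_zero] at this
  have h1 : ∀ f : IntervalDiff, intervalExtend f 1 = 1 := fun f => by
    have := intervalExtend_coe f 1
    rwa [act_top] at this
  have hd : ∀ (f : IntervalDiff) (x) (hx : x ∈ Ioo (0 : ℝ) 1),
      HasDerivAt (intervalExtend f) (f.deriv ⟨x, Ioo_subset_Icc_self hx⟩) x := fun f x hx =>
    (f.hasDerivWithinAt ⟨x, Ioo_subset_Icc_self hx⟩).hasDerivAt (Icc_mem_nhds hx.1 hx.2)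
  obtain ⟨x, hx, hx'⟩ := exists_deriv_eq_zero (f := fun t => intervalExtend f t - intervalExtend g t)
    zero_lt_one ((hcont f).sub (hcont g)) (by simp only [h0, h1]; norm_num)
  refine ⟨⟨x, Ioo_subset_Icc_self hx⟩, ?_⟩
  have := ((hd f x hx).sub (hd g x hx)).deriv
  exact sub_eq_zero.1 (this.symm.trans hx')

theorem exists_logDeriv_eq_zero (f : IntervalDiff) : ∃ x, f.logDeriv x = 0 := by
  obtain ⟨x, hx⟩ := exists_deriv_eq f 1
  exact ⟨x, by rw [logDeriv, hx, deriv_one, Real.log_one]⟩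

theorem dist_act_le (f : IntervalDiff) {ε : ℝ} (h : ∀ x, |f.deriv x - 1| ≤ ε) (x : unitInterval) :
    dist (f x) x ≤ ε := by
  have h1 := (convex_Icc (0 : ℝ) 1).norm_image_sub_le_of_norm_hasDerivWithin_le
    (f := fun t => intervalExtend f t - t) (f' := fun t => derivWithin (intervalExtend f) (Icc 0 1) t - 1)
    (C := ε) (fun t ht => (f.hasDerivWithinAt ⟨t, ht⟩).sub (hasDerivWithinAt_id t _))
    (fun t ht => h ⟨t, ht⟩) (x := 0) (y := x) (by simp) x.2
  have h0 : intervalExtend f 0 = 0 := by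
    have := intervalExtend_coe f 0
    rwa [act_zero] at this
  rw [h0, intervalExtend_coe, sub_zero, sub_zero, sub_zero, Real.norm_eq_abs, Real.norm_eq_abs] at h1
  have h2 : |(x : ℝ)| ≤ 1 := by rw [abs_of_nonneg x.2.1]; exact x.2.2
  have h3 : 0 ≤ ε := (abs_nonneg _).trans (h x)
  exact h1.trans (mul_le_of_le_one_right h3 h2)

/-- The normalization loses nothing: `log f'` vanishes somewhere, so a bound `δ / 2` on the
normalized cocycle bounds `log f'` by `δ`. Since `f` fixes `0`, a derivative near `1` then forces
`f` to be near the identity. -/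
theorem exists_forall_abs_relLogDeriv_le_imp_mem {U : Set IntervalDiff} (hU : U ∈ nhds 1) :
    ∃ δ > 0, ∀ f : IntervalDiff, (∀ x, |f.relLogDeriv x| ≤ δ) → f ∈ U := by
  obtain ⟨ε, hε, h⟩ := mem_nhds_iff.1 hU
  obtain ⟨δ, hδ, hlog⟩ := exists_pos_forall_abs_le_log_imp (half_pos hε)
  refine ⟨δ / 2, by positivity, fun f hf => ?_⟩
  have h1 : ∀ x, |f.deriv x - 1| < ε / 2 := by
    intro x
    obtain ⟨y, hy⟩ := f.exists_logDeriv_eq_zero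
    refine hlog _ (f.deriv_pos x) ?_
    have h1 := abs_le.1 (hf x)
    have h2 := abs_le.1 (hf y)
    rw [relLogDeriv] at h1 h2
    rw [hy] at h2
    change |f.logDeriv x| ≤ δ
    rw [abs_le]
    constructor <;> linarith
  refine h f (fun x => ?_) fun x => ?_
  · exact (f.dist_act_le (fun x => (h1 x).le) x).trans_lt (half_lt_self hε)
  · rw [deriv_one]; exact (h1 x).trans (half_lt_self hε)

theorem exists_logDeriv_eq {φ : unitInterval → ℝ} (hφ : Continuous φ) :
    ∃ (f : IntervalDiff) (k : ℝ), ∀ x, f.logDeriv x = φ x - k := by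
  obtain ⟨B, hB⟩ := exists_abs_le_of_continuous hφ
  obtain ⟨e, k, h0, h1, hmono, hd, hc, hc'⟩ := exists_homeomorph_of_log_deriv
    (φ := IccExtend zero_le_one φ) hφ.Icc_extend' (fun x => hB _)
  have hmem : ∀ x, e x ∈ Icc (0 : ℝ) 1 ↔ x ∈ Icc (0 : ℝ) 1 := fun x => by
    conv_lhs => rw [← h0, ← h1]
    exact and_congr hmono.le_iff_le hmono.le_iff_le
  let E : Equiv.Perm unitInterval := e.toEquiv.subtypeEquiv fun x => (hmem x).symm
  have hE : ∀ x ∈ Icc (0 : ℝ) 1, intervalExtend E x = e x := fun x hx =>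
    intervalExtend_coe E ⟨x, hx⟩
  have hE' : ∀ x ∈ Icc (0 : ℝ) 1, intervalExtend E.symm x = e.symm x := fun x hx =>
    intervalExtend_coe E.symm ⟨x, hx⟩
  let f : IntervalDiff :=
    ⟨E, fun x y hxy => hmono hxy, hc.contDiffOn.congr hE, hc'.contDiffOn.congr hE'⟩
  refine ⟨f, k, fun x => ?_⟩
  have h2 : f.deriv x = Real.exp (φ x - k) := deriv_eq <| by
    have h3 := ((hd x).hasDerivWithinAt (s := Icc 0 1)).congr hE (hE x x.2)
    rwa [IccExtend_val] at h3
  rw [logDeriv, h2, Real.log_exp]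

theorem isMaximalPseudometric_logDist : IsMaximalPseudometric logDist := by
  refine isContRightInvPseudometric_logDist.isMaximalPseudometric fun ρ hρ => ?_
  have hU : {h | ρ h 1 < 1} ∈ nhds (1 : IntervalDiff) := by
    have hcont : Continuous fun h => ρ h 1 := hρ.cont.comp (Continuous.prodMk_left 1)
    refine hcont.continuousAt.eventually_lt_const ?_
    exact (hρ.self_eq_zero 1).trans_lt one_pos
  obtain ⟨δ, hδ, h⟩ := exists_forall_abs_relLogDeriv_le_imp_mem hU
  have hnear : ∀ f g : IntervalDiff, (∀ x, |f.relLogDeriv x - g.relLogDeriv x| ≤ δ) → ρ f g ≤ 1 := by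
    intro f g hfg
    rw [hρ.eq_mul_inv_one]
    refine (h _ fun x => ?_).le
    obtain ⟨y, rfl⟩ := isBoundedCocycle_relLogDeriv.surjective g x
    rw [isBoundedCocycle_relLogDeriv.map_mul_inv]
    exact hfg y
  refine ⟨δ, hδ, 1, fun f => ?_⟩
  -- The unknown constant `k t` cancels after normalizing at `0`, so the normalized cocycle of `γ t`
  -- is exactly `t` times that of `f`.
  choose γ k hγ using fun t : ℝ => exists_logDeriv_eq (φ := fun x => t * f.relLogDeriv x)
    (continuous_const.mul (f.continuous_logDeriv.sub continuous_const))
  have hγ' : ∀ t x, (γ t).relLogDeriv x = t * f.relLogDeriv x := fun t x => by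
    have : f.relLogDeriv 0 = 0 := sub_self _
    rw [relLogDeriv, hγ, hγ, this]; ring
  refine ⟨γ, fun s t hst => hnear _ _ fun x => ?_, hnear _ _ fun x => ?_, hnear _ _ fun x => ?_⟩
  · rw [hγ', hγ', ← sub_mul, abs_mul]
    have h1 := isBoundedCocycle_relLogDeriv.abs_le f x
    rw [← logDist_eq] at h1
    have h2 : |s - t| * |f.relLogDeriv x| ≤ |s - t| * f.logDist 1 := by gcongr
    have h3 : 0 ≤ |s - t| * |f.relLogDeriv x| := by positivity
    linarith
  · rw [hγ']; simpa using hδ.le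
  · rw [hγ', isBoundedCocycle_relLogDeriv.map_one]; simpa using hδ.le

/-! ### Interval: hyperbolic periodic points and growth of powers -/

theorem not_isDistortedOrTorsion {f : IntervalDiff} (hf : f.HasHyperbolicPeriodicPoint) :
    ¬ IsDistortedOrTorsion f := by
  obtain ⟨x, q, hq, hx, hx1⟩ := hf
  set g := f ^ q with hg
  have hlog : g.logDeriv x ≠ 0 := Real.log_ne_zero_of_pos_of_ne_one (g.deriv_pos x) hx1
  have hpow := fun n => isBoundedCocycle_logDeriv.map_pow_of_fixed hx n
  have hpow0 := fun n => isBoundedCocycle_logDeriv.map_pow_of_fixed g.act_zero n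
  have hrel := fun n => isBoundedCocycle_relLogDeriv.abs_le (g ^ n)
  -- The normalization could cancel the growth at `x` if `0` is hyperbolic too. In that case the
  -- growth at `0` is compared with a point where `log (g ^ n)'` vanishes.
  by_cases h0 : g.logDeriv 0 = 0
  · refine isContRightInvPseudometric_logDist.not_isDistortedOrTorsion_of_pow hq
      (abs_pos.2 hlog) fun n => ?_
    refine le_trans (le_of_eq ?_) (hrel n x)
    rw [relLogDeriv, hpow, hpow0, h0, mul_zero, sub_zero, abs_mul, Nat.abs_cast, mul_comm]
  · refine isContRightInvPseudometric_logDist.not_isDistortedOrTorsion_of_pow hq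
      (abs_pos.2 h0) fun n => ?_
    obtain ⟨y, hy⟩ := (g ^ n).exists_logDeriv_eq_zero
    refine le_trans (le_of_eq ?_) (hrel n y)
    rw [relLogDeriv, hy, hpow0, zero_sub, abs_neg, abs_mul, Nat.abs_cast, mul_comm]

theorem exists_forall_le_logDeriv_pow {f : IntervalDiff} (hf : ¬ f.HasHyperbolicPeriodicPoint)
    {ε : ℝ} (hε : 0 < ε) : ∃ N : ℕ, ∀ n ≥ N, ∀ x, -(ε * n) ≤ (f ^ n).logDeriv x := by
  by_contra! hcon
  -- If the bound fails, `exists_contracting_periodic` applies on `[0, 1]` with `A = ⊥` and `4 * c =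
  -- ε`, and produces a hyperbolic periodic point.
  set ψ : ℝ → ℝ := IccExtend zero_le_one f.logDeriv with hψ
  have hsemi : Function.Semiconj ((↑) : unitInterval → ℝ) f (intervalExtend f) := fun x =>
    (intervalExtend_coe f x).symm
  have hsum : ∀ n (x : unitInterval), birkhoffSum (intervalExtend f) ψ n x =
      (f ^ n).logDeriv x := fun n x => by
    rw [← birkhoffSum_comp_semiconj hsemi, isBoundedCocycle_logDeriv.map_pow]
    congr 1
    exact funext fun y => IccExtend_val zero_le_one f.logDeriv y
  obtain ⟨B, hB⟩ := isBoundedCocycle_logDeriv.bounded f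
  obtain ⟨n, hn, z, hz, hfix, hneg⟩ := exists_contracting_periodic (convex_Icc (0 : ℝ) 1) isClosed_Icc
    (A := ⊥) (by rintro a ha x hx; rw [AddSubgroup.mem_bot.1 ha, add_zero]; exact hx)
    (fun x hx => ⟨0, zero_mem _, by rwa [add_zero]⟩) f.mapsTo_intervalExtend (ψ := ψ)
    (fun x hx => by
      have := f.hasDerivWithinAt ⟨x, hx⟩
      rwa [← exp_logDeriv, ← IccExtend_of_mem zero_le_one f.logDeriv hx] at this)
    (isCompact_Icc.uniformContinuousOn_of_continuous
      f.continuous_logDeriv.Icc_extend'.continuousOn) (B := |B| + 1) (by positivity)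
    (fun x _ => by
      have := (abs_le.1 (hB (projIcc 0 1 zero_le_one x))).1
      have h2 := le_abs_self B
      rw [hψ, IccExtend, Function.comp_apply]
      linarith) (c := ε / 4) (by positivity)
    (fun N => by
      obtain ⟨n, hn, x, hx⟩ := hcon N
      refine ⟨n, hn, x, x.2, ?_⟩
      rw [hsum]
      linarith)
  refine hf ⟨⟨z, hz⟩, n, hn, ?_, fun h1 => ?_⟩
  · refine (isBoundedCocycle_logDeriv.act_pow f n ⟨z, hz⟩).trans (Subtype.ext ?_)
    rw [(hsemi.iterate_right n).eq]
    exact (sub_eq_zero.1 (AddSubgroup.mem_bot.1 hfix)).symm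
  · rw [hsum n ⟨z, hz⟩, logDeriv, h1, Real.log_one] at hneg
    exact lt_irrefl _ hneg

theorem HasHyperbolicPeriodicPoint.of_inv {f : IntervalDiff}
    (hf : f⁻¹.HasHyperbolicPeriodicPoint) : f.HasHyperbolicPeriodicPoint := by
  obtain ⟨x, q, hq, hx, h1⟩ := hf
  rw [inv_pow] at hx h1
  have hx' : (f ^ q) x = x := by
    conv_lhs => rw [← hx, ← act_mul, mul_inv_cancel, act_one]
  refine ⟨x, q, hq, hx', fun h => h1 ?_⟩
  have := deriv_mul (f ^ q)⁻¹ (f ^ q) x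
  rwa [inv_mul_cancel, deriv_one, hx', h, mul_one, eq_comm] at this

theorem isDistortedOrTorsion {f : IntervalDiff} (hf : ¬ f.HasHyperbolicPeriodicPoint) :
    IsDistortedOrTorsion f := by
  refine isMaximalPseudometric_logDist.isDistortedOrTorsion fun ε hε => ?_
  obtain ⟨N, hN⟩ := isBoundedCocycle_logDeriv.abs_map_pow_le
    (exists_forall_le_logDeriv_pow hf (half_pos hε))
    (exists_forall_le_logDeriv_pow (mt HasHyperbolicPeriodicPoint.of_inv hf) (half_pos hε))
  refine ⟨N, fun n hn => ciSup_le fun x => ?_⟩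
  change |(f ^ n).relLogDeriv x - (1 : IntervalDiff).relLogDeriv x| ≤ _
  rw [isBoundedCocycle_relLogDeriv.map_one, sub_zero, relLogDeriv]
  refine (abs_sub _ _).trans ?_
  linarith [hN n hn x, hN n hn 0]

end IntervalDiff

/-! ### Diffeomorphisms of the circle -/

namespace CircleDiff

theorem act_mul (f g : CircleDiff) (x : UnitAddCircle) : (f * g) x = f (g x) := rfl

theorem act_one (x : UnitAddCircle) : (1 : CircleDiff) x = x := rfl

theorem exists_lift (f : CircleDiff) : ∃ F, IsC1Lift F f := f.2.1

theorem exists_coe_eq (x : UnitAddCircle) : ∃ t : ℝ, (t : UnitAddCircle) = x :=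
  QuotientAddGroup.mk_surjective x

theorem hasDerivAt {f : CircleDiff} {F : CircleDeg1Lift} (hF : IsC1Lift F f) (t : ℝ) :
    HasDerivAt F (f.deriv t) t := by
  rw [deriv_coe f hF]
  exact (hF.1.differentiable one_ne_zero t).hasDerivAt

theorem deriv_mul (f g : CircleDiff) (x : UnitAddCircle) :
    (f * g).deriv x = f.deriv (g x) * g.deriv x := by
  obtain ⟨F, hF⟩ := f.exists_lift
  obtain ⟨G, hG⟩ := g.exists_lift
  obtain ⟨t, rfl⟩ := exists_coe_eq x
  have h1 := hasDerivAt hF (G t)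
  rw [hG.2] at h1
  rw [deriv_coe (f * g) (hF.mul hG)]
  exact (h1.comp t (hasDerivAt hG t)).deriv

theorem deriv_one (x : UnitAddCircle) : (1 : CircleDiff).deriv x = 1 := by
  obtain ⟨t, rfl⟩ := exists_coe_eq x
  rw [deriv_coe 1 IsC1Lift.one]
  exact (hasDerivAt_id t).deriv

theorem deriv_pos (f : CircleDiff) (x : UnitAddCircle) : 0 < f.deriv x := by
  have h1 : f⁻¹.deriv (f x) * f.deriv x = 1 := by rw [← deriv_mul, inv_mul_cancel, deriv_one]
  have h2 : 0 ≤ f.deriv x := by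
    obtain ⟨F, hF⟩ := f.exists_lift
    obtain ⟨t, rfl⟩ := exists_coe_eq x
    rw [deriv_coe f hF]
    exact F.monotone.deriv_nonneg
  exact lt_of_le_of_ne h2 fun h => by rw [← h, mul_zero] at h1; exact zero_ne_one h1

theorem continuous_deriv (f : CircleDiff) : Continuous f.deriv := by
  obtain ⟨F, hF⟩ := f.exists_lift
  refine (QuotientAddGroup.isOpenQuotientMap_mk (G := ℝ)).isQuotientMap.continuous_iff.2 ?_
  exact (hF.1.continuous_deriv le_rfl).congr fun t => (deriv_coe f hF t).symm

/-- The logarithmic derivative. -/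
def logDeriv (f : CircleDiff) (x : UnitAddCircle) : ℝ := Real.log (f.deriv x)

theorem exp_logDeriv (f : CircleDiff) (x : UnitAddCircle) : Real.exp (f.logDeriv x) = f.deriv x :=
  Real.exp_log (f.deriv_pos x)

theorem continuous_logDeriv (f : CircleDiff) : Continuous f.logDeriv :=
  f.continuous_deriv.log fun x => (f.deriv_pos x).ne'

theorem logDeriv_mul (f g : CircleDiff) (x : UnitAddCircle) :
    (f * g).logDeriv x = f.logDeriv (g x) + g.logDeriv x := by
  rw [logDeriv, deriv_mul, Real.log_mul (f.deriv_pos _).ne' (g.deriv_pos _).ne']; rfl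

theorem exists_abs_le_of_continuous {φ : UnitAddCircle → ℝ} (hφ : Continuous φ) :
    ∃ B, ∀ x, |φ x| ≤ B := by
  obtain ⟨B, hB⟩ := isCompact_univ.exists_bound_of_continuousOn hφ.continuousOn
  exact ⟨B, fun x => hB x (mem_univ x)⟩

theorem isBoundedCocycle_logDeriv :
    IsBoundedCocycle (fun f : CircleDiff => (f : UnitAddCircle → UnitAddCircle)) logDeriv :=
  ⟨act_one, act_mul, logDeriv_mul, fun f => exists_abs_le_of_continuous f.continuous_logDeriv⟩

theorem logDist_eq : logDist = cocycleDist logDeriv := rfl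

theorem mem_nhds_iff {g : CircleDiff} {U : Set CircleDiff} :
    U ∈ nhds g ↔ ∃ ε > 0, ∀ h : CircleDiff, (∀ x, dist (h x) (g x) < ε) →
      (∀ x, |h.deriv x - g.deriv x| < ε) → h ∈ U :=
  mem_nhds_induced_uniformFun (e := fun f : CircleDiff => (f : UnitAddCircle → UnitAddCircle))
    (D := deriv) rfl

/-! ### Circle: continuity and maximality of the logarithmic distance -/

theorem exists_pos_le_deriv (f : CircleDiff) : ∃ m > 0, ∀ x, m ≤ f.deriv x := by
  obtain ⟨x, -, hx⟩ := isCompact_univ.exists_isMinOn univ_nonempty f.continuous_deriv.continuousOn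
  exact ⟨f.deriv x, f.deriv_pos x, fun y => hx (mem_univ y)⟩

theorem isContRightInvPseudometric_logDist : IsContRightInvPseudometric logDist := by
  rw [logDist_eq]
  refine isBoundedCocycle_logDeriv.isContRightInvPseudometric fun f ε hε => ?_
  obtain ⟨m, hm, hfm⟩ := f.exists_pos_le_deriv
  obtain ⟨δ, hδ, h⟩ := exists_abs_log_sub_log_le hm hε
  exact mem_nhds_iff.2 ⟨δ, hδ, fun g _ hg x => h _ _ (hfm x) (hg x)⟩

/-- Rolle's theorem for the difference of two lifts, which is `1`-periodic. -/
theorem exists_deriv_eq (f g : CircleDiff) : ∃ x, f.deriv x = g.deriv x := by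
  obtain ⟨F, hF⟩ := f.exists_lift
  obtain ⟨G, hG⟩ := g.exists_lift
  obtain ⟨t, -, ht⟩ := exists_deriv_eq_zero (f := fun t => F t - G t) zero_lt_one
    (hF.1.continuous.sub hG.1.continuous).continuousOn (by
      have h1 := F.map_add_one 0
      have h2 := G.map_add_one 0
      rw [zero_add] at h1 h2
      rw [h1, h2]; ring)
  exact ⟨t, sub_eq_zero.1 (((hasDerivAt hF t).sub (hasDerivAt hG t)).deriv.symm.trans ht)⟩

theorem exists_logDeriv_eq_logDeriv (f g : CircleDiff) : ∃ x, f.logDeriv x = g.logDeriv x := by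
  obtain ⟨x, hx⟩ := exists_deriv_eq f g
  exact ⟨x, by rw [logDeriv, logDeriv, hx]⟩

theorem norm_coe_le (t : ℝ) : ‖(t : UnitAddCircle)‖ ≤ |t| := by
  rw [UnitAddCircle.norm_eq]
  simpa using round_le t 0

theorem dist_act_le (f : CircleDiff) {ε : ℝ} (h : ∀ x, |f.deriv x - 1| ≤ ε) {x₀ : UnitAddCircle}
    (hx₀ : f x₀ = x₀) (x : UnitAddCircle) : dist (f x) x ≤ ε := by
  obtain ⟨F, hF⟩ := f.exists_lift
  obtain ⟨t₀, rfl⟩ := exists_coe_eq x₀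
  obtain ⟨b, hb, hbx⟩ := AddCircle.eq_coe_Ico (x - (t₀ : UnitAddCircle))
  have hx : x = ((t₀ + b : ℝ) : UnitAddCircle) := by rw [AddCircle.coe_add, hbx]; abel
  have h1 := convex_univ.norm_image_sub_le_of_norm_hasDerivWithin_le
    (f := fun t => F t - t) (f' := fun t => f.deriv t - 1)
    (C := ε) (fun t _ => ((hasDerivAt hF t).sub (hasDerivAt_id t)).hasDerivWithinAt)
    (fun t _ => h t) (mem_univ t₀) (mem_univ (t₀ + b))
  -- The displacement `F t₀ - t₀` over the fixed point is zero in the circle, so the displacement at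
  -- `x` is the variation of `F t - t` over an interval of length `b < 1`.
  have h2 : dist (f x) x = ‖((F (t₀ + b) - (t₀ + b) - (F t₀ - t₀) : ℝ) : UnitAddCircle)‖ := by
    rw [dist_eq_norm, AddCircle.coe_sub, AddCircle.coe_sub, AddCircle.coe_sub, hF.2, hF.2, hx₀,
      sub_self, sub_zero, hx]
  have h3 : 0 ≤ ε := (abs_nonneg _).trans (h x)
  rw [h2]
  refine (norm_coe_le _).trans (h1.trans (mul_le_of_le_one_right h3 ?_))
  rw [add_sub_cancel_left, Real.norm_eq_abs, abs_of_nonneg hb.1]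
  exact hb.2.le

/-- The fixed point is essential: rotations have zero logarithmic derivative without being near the
identity. -/
theorem exists_forall_abs_logDeriv_le_imp_mem {U : Set CircleDiff} (hU : U ∈ nhds 1) :
    ∃ δ > 0, ∀ f : CircleDiff, (∃ x, f x = x) → (∀ x, |f.logDeriv x| ≤ δ) → f ∈ U := by
  obtain ⟨ε, hε, h⟩ := mem_nhds_iff.1 hU
  obtain ⟨δ, hδ, hlog⟩ := exists_pos_forall_abs_le_log_imp (half_pos hε)
  refine ⟨δ, hδ, fun f ⟨x₀, hx₀⟩ hf => ?_⟩
  have h1 : ∀ x, |f.deriv x - 1| < ε / 2 := fun x => hlog _ (f.deriv_pos x) (hf x)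
  refine h f (fun x => ?_) fun x => ?_
  · exact (f.dist_act_le (fun x => (h1 x).le) hx₀ x).trans_lt (half_lt_self hε)
  · rw [deriv_one]; exact (h1 x).trans (half_lt_self hε)

theorem exists_isC1Lift (F G : CircleDeg1Lift) (hF : ContDiff ℝ 1 F) (hG : ContDiff ℝ 1 G)
    (h1 : ∀ t, G (F t) = t) (h2 : ∀ t, F (G t) = t) : ∃ f : CircleDiff, IsC1Lift F f := by
  have hper : ∀ F : CircleDeg1Lift,
      Function.Periodic (fun t => ((F t : ℝ) : UnitAddCircle)) 1 := fun F t => by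
    simp only [F.map_add_one, AddCircle.coe_add_period]
  have hinv : ∀ F G : CircleDeg1Lift, (∀ t, G (F t) = t) →
      Function.LeftInverse (hper G).lift (hper F).lift := fun F G h x => by
    obtain ⟨t, rfl⟩ := exists_coe_eq x
    rw [Function.Periodic.lift_coe, Function.Periodic.lift_coe, h]
  exact ⟨⟨⟨(hper F).lift, (hper G).lift, hinv F G h1, hinv G F h2⟩, ⟨F, hF, fun t => rfl⟩,
    ⟨G, hG, fun t => rfl⟩⟩, hF, fun t => rfl⟩

theorem exists_rotation (a : UnitAddCircle) :
    ∃ f : CircleDiff, (∀ x, f x = a + x) ∧ ∀ x, f.deriv x = 1 := by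
  obtain ⟨s, rfl⟩ := exists_coe_eq a
  let T : ℝ → CircleDeg1Lift := fun s =>
    ⟨⟨fun t => s + t, fun _ _ h => add_le_add_right h s⟩, fun t => (add_assoc s t 1).symm⟩
  have hT : ∀ s t, T s t = s + t := fun s t => rfl
  have hc : ∀ s, ContDiff ℝ 1 (T s) := fun s => contDiff_const.add contDiff_id
  obtain ⟨f, hf⟩ := exists_isC1Lift (T s) (T (-s)) (hc s) (hc (-s))
    (fun t => by simp [hT]) (fun t => by simp [hT])
  refine ⟨f, fun x => ?_, fun x => ?_⟩
  · obtain ⟨t, rfl⟩ := exists_coe_eq x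
    rw [← hf.2, hT, AddCircle.coe_add]
  · obtain ⟨t, rfl⟩ := exists_coe_eq x
    rw [deriv_coe f hf]
    exact ((hasDerivAt_id t).const_add s).deriv

theorem exists_logDeriv_eq {φ : UnitAddCircle → ℝ} (hφ : Continuous φ) :
    ∃ (f : CircleDiff) (k : ℝ), f 0 = 0 ∧ ∀ x, f.logDeriv x = φ x - k := by
  obtain ⟨B, hB⟩ := exists_abs_le_of_continuous hφ
  obtain ⟨e, k, h0, h1, hmono, hd, hc, hc'⟩ := exists_homeomorph_of_log_deriv
    (φ := fun t => φ (t : UnitAddCircle)) (hφ.comp (AddCircle.continuous_mk' 1)) (fun x => hB _)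
  -- Periodicity of the density makes `e (t + 1) - e t` constant, equal to its value `1` at `t = 0`.
  have hadd : ∀ t, e (t + 1) = e t + 1 := by
    have hd' : ∀ t, HasDerivAt (fun t => e (t + 1) - e t) 0 t := fun t => by
      have := ((hd (t + 1)).comp_add_const t 1).sub (hd t)
      rwa [AddCircle.coe_add_period, sub_self] at this
    have hconst := is_const_of_deriv_eq_zero (fun t => (hd' t).differentiableAt)
      (fun t => (hd' t).deriv)
    intro t
    have := hconst t 0
    rw [zero_add, h0, h1] at this
    linarith
  have hadd' : ∀ t, e.symm (t + 1) = e.symm t + 1 := fun t => by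
    rw [e.symm_apply_eq, hadd, e.apply_symm_apply]
  have hmono' : Monotone e.symm := fun x y hxy => by
    rw [← hmono.le_iff_le, e.apply_symm_apply, e.apply_symm_apply]; exact hxy
  obtain ⟨f, hf⟩ := exists_isC1Lift ⟨⟨e, hmono.monotone⟩, hadd⟩ ⟨⟨e.symm, hmono'⟩, hadd'⟩ hc hc'
    e.symm_apply_apply e.apply_symm_apply
  refine ⟨f, k, ?_, fun x => ?_⟩
  · have h2 := hf.2 0
    have h3 : (((e 0 : ℝ)) : UnitAddCircle) = f ((0 : ℝ) : UnitAddCircle) := h2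
    rw [h0] at h3
    exact h3.symm
  · obtain ⟨t, rfl⟩ := exists_coe_eq x
    rw [logDeriv, deriv_coe f hf]
    exact (congrArg Real.log (hd t).deriv).trans (Real.log_exp _)

theorem isMaximalPseudometric_logDist : IsMaximalPseudometric logDist := by
  refine isContRightInvPseudometric_logDist.isMaximalPseudometric fun ρ hρ => ?_
  have hcont : Continuous fun h => ρ h 1 := hρ.cont.comp (Continuous.prodMk_left 1)
  have hU : {h | ρ h 1 < 1} ∈ nhds (1 : CircleDiff) := by
    refine hcont.continuousAt.eventually_lt_const ?_
    exact (hρ.self_eq_zero 1).trans_lt one_pos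
  obtain ⟨δ, hδ, h⟩ := exists_forall_abs_logDeriv_le_imp_mem hU
  have hnear : ∀ f g : CircleDiff, (∃ x, f x = g x) →
      (∀ x, |f.logDeriv x - g.logDeriv x| ≤ δ) → ρ f g ≤ 1 := by
    rintro f g ⟨x₀, hx₀⟩ hfg
    rw [hρ.eq_mul_inv_one]
    refine (h _ ⟨g x₀, ?_⟩ fun x => ?_).le
    · rw [act_mul, ← act_mul g⁻¹, inv_mul_cancel, act_one, hx₀]
    · obtain ⟨y, rfl⟩ := isBoundedCocycle_logDeriv.surjective g x
      rw [isBoundedCocycle_logDeriv.map_mul_inv]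
      exact hfg y
  choose R hR hR1 using exists_rotation
  have hRcont : Continuous R := continuous_iff_continuousAt.2 fun a U hU => by
    obtain ⟨ε, hε, hεU⟩ := mem_nhds_iff.1 hU
    refine Filter.mem_map.2 (Filter.mem_of_superset (Metric.ball_mem_nhds a hε) fun b hb => ?_)
    refine hεU _ (fun x => ?_) fun x => ?_
    · rw [hR, hR, dist_add_right]; exact hb
    · rw [hR1, hR1, sub_self, abs_zero]; exact hε
  -- Rotations are a continuous image of the compact circle, so their `ρ`-distance to the identity
  -- is bounded.
  obtain ⟨C, hC⟩ := exists_abs_le_of_continuous (hcont.comp hRcont)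
  have hC0 : 0 ≤ C := (abs_nonneg _).trans (hC 0)
  have hRlog : ∀ a x, (R a).logDeriv x = 0 := fun a x => by rw [logDeriv, hR1, Real.log_one]
  refine ⟨δ, hδ, C + 1, fun f => ?_⟩
  choose γ k hγ0 hγ using fun t : ℝ => exists_logDeriv_eq (φ := fun x => t * f.logDeriv x)
    (continuous_const.mul f.continuous_logDeriv)
  refine ⟨γ, fun s t hst => hnear _ _ ⟨0, by rw [hγ0, hγ0]⟩ fun x => ?_, ?_, ?_⟩
  -- Equality of the derivatives at `y` gives `k s - k t = (s - t) * log f'(y)`. The variation of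
  -- the constant thus costs as much as the main term, whence the factor `2` in the maximality
  -- criterion.
  · obtain ⟨y, hy⟩ := exists_logDeriv_eq_logDeriv (γ s) (γ t)
    have hb := fun x => isBoundedCocycle_logDeriv.abs_le f x
    rw [← logDist_eq] at hb
    have h2 : ∀ x, |(s - t) * f.logDeriv x| ≤ |s - t| * f.logDist 1 := fun x => by
      rw [abs_mul]
      exact mul_le_mul_of_nonneg_left (hb x) (abs_nonneg _)
    have hx := abs_le.1 (h2 x)
    have hy' := abs_le.1 (h2 y)
    rw [hγ, hγ] at hy
    rw [hγ, hγ, abs_le]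
    constructor <;> linarith
  · have hk : k 1 = 0 := by
      obtain ⟨y, hy⟩ := exists_logDeriv_eq_logDeriv (γ 1) f
      rw [hγ] at hy
      linarith
    -- Both sides have the same derivative and the same value at `0`; `γ 1` fixes `0`, so the
    -- rotation supplies `f 0`.
    have h1 : ρ f (R (f 0) * γ 1) ≤ 1 := by
      refine hnear _ _ ⟨0, by rw [act_mul, hγ0, hR, add_zero]⟩ fun x => ?_
      rw [logDeriv_mul, hRlog, hγ, hk]
      simpa using hδ.le
    have h2 := hρ.triangle f (R (f 0) * γ 1) (γ 1)
    have h3 := hρ.right_inv (R (f 0)) 1 (γ 1)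
    rw [one_mul] at h3
    have h4 := le_of_abs_le (hC (f 0))
    dsimp only [Function.comp_apply] at h4
    linarith
  · have hk : k 0 = 0 := by
      obtain ⟨y, hy⟩ := exists_logDeriv_eq_logDeriv (γ 0) 1
      rw [hγ, isBoundedCocycle_logDeriv.map_one] at hy
      linarith
    refine (hnear _ _ ⟨0, hγ0 0⟩ fun x => ?_).trans (by linarith)
    rw [hγ, hk, isBoundedCocycle_logDeriv.map_one]
    simpa using hδ.le

/-! ### Circle: hyperbolic periodic points and growth of powers -/

theorem not_isDistortedOrTorsion {f : CircleDiff} (hf : f.HasHyperbolicPeriodicPoint) :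
    ¬ IsDistortedOrTorsion f := by
  obtain ⟨x, q, hq, hx, hx1⟩ := hf
  have hlog : (f ^ q).logDeriv x ≠ 0 :=
    Real.log_ne_zero_of_pos_of_ne_one ((f ^ q).deriv_pos x) hx1
  refine isContRightInvPseudometric_logDist.not_isDistortedOrTorsion_of_pow hq
    (abs_pos.2 hlog) fun n => ?_
  refine le_trans (le_of_eq ?_) (isBoundedCocycle_logDeriv.abs_le ((f ^ q) ^ n) x)
  rw [isBoundedCocycle_logDeriv.map_pow_of_fixed hx n, abs_mul, Nat.abs_cast, mul_comm]

theorem exists_forall_le_logDeriv_pow {f : CircleDiff} (hf : ¬ f.HasHyperbolicPeriodicPoint)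
    {ε : ℝ} (hε : 0 < ε) : ∃ N : ℕ, ∀ n ≥ N, ∀ x, -(ε * n) ≤ (f ^ n).logDeriv x := by
  by_contra! hcon
  obtain ⟨F, hF⟩ := f.exists_lift
  set ψ : ℝ → ℝ := f.logDeriv ∘ ((↑) : ℝ → UnitAddCircle) with hψ
  have hsemi : Function.Semiconj ((↑) : ℝ → UnitAddCircle) F f := hF.2
  have hsum : ∀ n (t : ℝ), birkhoffSum F ψ n t = (f ^ n).logDeriv t := fun n t => by
    rw [birkhoffSum_comp_semiconj hsemi, isBoundedCocycle_logDeriv.map_pow]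
  obtain ⟨B, hB⟩ := isBoundedCocycle_logDeriv.bounded f
  have hunif : UniformContinuous ψ := by
    refine (CompactSpace.uniformContinuous_of_continuous f.continuous_logDeriv).comp ?_
    refine (LipschitzWith.of_dist_le_mul (K := 1) fun s t => ?_).uniformContinuous
    rw [dist_eq_norm, ← AddCircle.coe_sub, NNReal.coe_one, one_mul]
    exact norm_coe_le _
  -- On the line, with `A = ℤ`: periodic up to an integer translation for the lift means periodic on
  -- the circle.
  obtain ⟨n, hn, z, -, hfix, hneg⟩ := exists_contracting_periodic convex_univ isClosed_univ
    (A := AddSubgroup.zmultiples (1 : ℝ)) (fun _ _ _ _ => mem_univ _)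
    (fun x _ => ⟨-(⌊x⌋ : ℝ), ⟨-⌊x⌋, by simp⟩, by
      rw [← sub_eq_add_neg]
      exact ⟨Int.fract_nonneg x, (Int.fract_lt_one x).le⟩⟩) (mapsTo_univ F univ) (ψ := ψ)
    (fun t _ => by
      have := (hasDerivAt hF t).hasDerivWithinAt (s := univ)
      rwa [← exp_logDeriv] at this)
    hunif.uniformContinuousOn (B := |B| + 1) (by positivity)
    (fun x _ => by
      have := (abs_le.1 (hB x)).1
      have h2 := le_abs_self B
      rw [hψ, Function.comp_apply]
      linarith) (c := ε / 4) (by positivity)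
    (fun N => by
      obtain ⟨n, hn, x, hx⟩ := hcon N
      obtain ⟨t, rfl⟩ := exists_coe_eq x
      refine ⟨n, hn, t, mem_univ t, ?_⟩
      rw [hsum]
      linarith)
  refine hf ⟨z, n, hn, ?_, fun h1 => ?_⟩
  · refine (isBoundedCocycle_logDeriv.act_pow f n z).trans ?_
    rw [← (hsemi.iterate_right n).eq, eq_comm, ← sub_eq_zero, ← AddCircle.coe_sub]
    obtain ⟨m, hm⟩ := hfix
    exact (AddCircle.coe_eq_zero_iff 1).2 ⟨m, hm⟩
  · rw [hsum, logDeriv, h1, Real.log_one] at hneg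
    exact lt_irrefl _ hneg

theorem HasHyperbolicPeriodicPoint.of_inv {f : CircleDiff}
    (hf : f⁻¹.HasHyperbolicPeriodicPoint) : f.HasHyperbolicPeriodicPoint := by
  obtain ⟨x, q, hq, hx, h1⟩ := hf
  rw [inv_pow] at hx h1
  have hx' : (f ^ q) x = x := by
    conv_lhs => rw [← hx, ← act_mul, mul_inv_cancel, act_one]
  refine ⟨x, q, hq, hx', fun h => h1 ?_⟩
  have := deriv_mul (f ^ q)⁻¹ (f ^ q) x
  rwa [inv_mul_cancel, deriv_one, hx', h, mul_one, eq_comm] at this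

theorem isDistortedOrTorsion {f : CircleDiff} (hf : ¬ f.HasHyperbolicPeriodicPoint) :
    IsDistortedOrTorsion f := by
  refine isMaximalPseudometric_logDist.isDistortedOrTorsion fun ε hε => ?_
  obtain ⟨N, hN⟩ := isBoundedCocycle_logDeriv.abs_map_pow_le
    (exists_forall_le_logDeriv_pow hf hε)
    (exists_forall_le_logDeriv_pow (mt HasHyperbolicPeriodicPoint.of_inv hf) hε)
  refine ⟨N, fun n hn => ciSup_le fun x => ?_⟩
  change |(f ^ n).logDeriv x - (1 : CircleDiff).logDeriv x| ≤ _
  rw [isBoundedCocycle_logDeriv.map_one, sub_zero]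
  exact hN n hn x

end CircleDiff

end

theorem theorem1 :
    (IsMaximalPseudometric CircleDiff.logDist ∧
      ∀ f : CircleDiff, ¬ IsDistortedOrTorsion f ↔ f.HasHyperbolicPeriodicPoint) ∧
    (IsMaximalPseudometric IntervalDiff.logDist ∧
      ∀ f : IntervalDiff, ¬ IsDistortedOrTorsion f ↔ f.HasHyperbolicPeriodicPoint) :=
  ⟨⟨CircleDiff.isMaximalPseudometric_logDist, fun _ =>
      ⟨fun h => by_contra fun h' => h (CircleDiff.isDistortedOrTorsion h'),
        CircleDiff.not_isDistortedOrTorsion⟩⟩,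
    IntervalDiff.isMaximalPseudometric_logDist, fun _ =>
      ⟨fun h => by_contra fun h' => h (IntervalDiff.isDistortedOrTorsion h'),
        IntervalDiff.not_isDistortedOrTorsion⟩⟩
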